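/- A \emph{knot projection} $P$ is (the image of) a generic immersion of a circle into the $2$-sphere $S^2$, whose only singularities are $n \ge 0$ transverse double points; $U$ denotes the simple closed curve, the knot projection with $n=0$. Knot projections are considered up to homeomorphism of $S^2$, and $P$ is recorded by the cyclic sequence of the $2n$ passages through double points, the pairing of these passages, and the direction in which the branches cross; a diagram of this kind is a knot projection exactly if the closed oriented surface formed by its double points, edges and regions is a sphere (Euler characteristic $2$). The \emph{chord diagram} $CD_P$ is the circle with the two preimages of each double point joined by a chord. Let $\mathrm{X}(P)$ be the number of pairs of chords of $CD_P$ that cross each other, and $\mathrm{Tr}(P)$ the number of triple chords, i.e. of triples of chords of $CD_P$ any two of which cross each other. The move $1b$ removes a $1$-gon, i.e. a region of $S^2\setminus P$ bounded by one edge, together with its double point. The move $s2b$ removes a strong $2$-gon, i.e. a region of $S^2\setminus P$ bounded by two edges between two double points such that an orientation of $P$ orients the boundary of the region coherently, together with its two double points. Let $\mathcal S$ be the set of knot projections obtained from $U$ by a finite sequence of inverses of moves $1b$ and inverses of moves $s2b$. For a knot projection $P$ with exactly $n$ double points, let $a_2(P)$ be the average of $a_2(K)$ over the $2^n$ knots $K$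 obtained from $P$ by choosing over/under information at every double point, where $a_2(K)$ is the coefficient of $z^2$ in the Conway polynomial $\nabla_K(z)$ (determined by $\nabla_{L_+}-\nabla_{L_-}=z\nabla_{L_0}$, $\nabla=1$ for the unknot, and $\nabla=0$ for trivial links with several components). Put $(J^+ + 2St)(P) = 8\,a_2(P)$. Then \[ \{P \mid (J^+ + 2St)(P)=0\} \supseteq \mathcal S \supseteq \{P \mid \mathrm{Tr}(P)=0\} \supseteq \{P \mid \mathrm{X}(P)=0\}. \] -/

import Mathlib

open Polynomial

/-- The combinatorial data of a generically immersed oriented circle with `n` transverse double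
points in an oriented surface.  The `2 * n` preimages of the double points ("passages") are numbered
`0, 1, …, 2 * n - 1` in the order in which they are met along the circle, starting from a base point
on it; the passage after `i` is `finRotate _ i`.
* `partner i` is the other passage through the same double point;
* `left i` says that at the passage `i` the other branch crosses the branch of `i` from its right
  to its left. -/
structure CurveDiagram where
  n : ℕ
  partner : Fin (2 * n) → Fin (2 * n)
  partner_partner : ∀ i, partner (partner i) = i
  partner_ne : ∀ i, partner i ≠ i
  left : Fin (2 * n) → Bool
  left_partner : ∀ i, left (partner i) = !left i

namespace CurveDiagram

/-- Walking along the boundary of a region which is kept on the left-hand side.  The edge number `i`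
runs from the passage `i` to the passage `finRotate _ i`; the pair `(i, true)` stands for this edge
walked along the orientation of the curve, `(i, false)` for the edge walked against it.  At the
double point reached one turns left. -/
def turn (D : CurveDiagram) : Fin (2 * D.n) × Bool → Fin (2 * D.n) × Bool
  | (i, true) =>
      if D.left (finRotate _ i) then (D.partner (finRotate _ i), true)
      else ((finRotate _).symm (D.partner (finRotate _ i)), false)
  | (i, false) =>
      if D.left i then ((finRotate _).symm (D.partner i), false)
      else (D.partner i, true)

/-- The regions, i.e. the closed boundary walks. -/
def Region (D : CurveDiagram) : Type := Quot fun a b => D.turn a = b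

end CurveDiagram

/-- A knot projection, i.e. a generic closed curve on the `2`-sphere up to homeomorphism, together
with a base point and an orientation of the curve.  It is given by its double points, its edges and
its regions; the regions of a curve on the sphere are disks, and the closed oriented surface made of
these cells has to be the sphere, i.e. to have Euler characteristic `2`.  (If there are no double points, the curve is the simple closed curve `U`.) -/
structure KnotProjection extends CurveDiagram where
  sphere : n ≠ 0 → (n : ℤ) - (2 * n : ℕ) + Nat.card toCurveDiagram.Region = 2

/-- An oriented link diagram, recorded along its components.  On the components there are `m`
points, numbered by `Fin m`; `next i` is the point following `i` along its component.  If
`partner i ≠ i`, then `i` is a passage through a crossing, whose other passage is `partner i`; if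
`partner i = i`, then `i` is merely a marked point of its component.  `upper i` says that the passage
`i` is the upper one, `left i` that the other branch crosses from the right to the left of the
branch of `i`.  Besides, there are `free` components which carry no point. -/
structure LinkDiagram (m : ℕ) where
  next : Equiv.Perm (Fin m)
  partner : Fin m → Fin m
  partner_partner : ∀ i, partner (partner i) = i
  upper : Fin m → Bool
  upper_partner : ∀ i, partner i ≠ i → upper (partner i) = !upper i
  left : Fin m → Bool
  left_partner : ∀ i, partner i ≠ i → left (partner i) = !left i
  free : ℕ

namespace LinkDiagram

variable {m : ℕ}

/-- The number of components. -/
noncomputable def components (D : LinkDiagram m) : ℕ :=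
  Nat.card (Quot fun a b => D.next a = b) + D.free

/-- The sign of the crossing at `i`: it is positive if the lower branch crosses the upper one from
the right to the left. -/
def sign (D : LinkDiagram m) (i : Fin m) : ℤ := if D.left i = D.upper i then 1 else -1

/-- Exchange the upper and the lower branch at the crossing of `i`. -/
def switch (D : LinkDiagram m) (i : Fin m) : LinkDiagram m where
  next := D.next
  partner := D.partner
  partner_partner := D.partner_partner
  upper k := if k = i ∨ k = D.partner i then !D.upper k else D.upper k
  upper_partner k hk := by
    have h1 : (D.partner k = i ∨ D.partner k = D.partner i) ↔ (k = i ∨ k = D.partner i) := by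
      have h := D.partner_partner
      grind
    simp only [h1, D.upper_partner k hk]
    split_ifs <;> rfl
  left := D.left
  left_partner := D.left_partner
  free := D.free

/-- Smooth the crossing of `i` according to the orientation: who arrives at one passage leaves from
the other one.  The two passages become marked points. -/
def smooth (D : LinkDiagram m) (i : Fin m) : LinkDiagram m where
  next := (Equiv.swap i (D.partner i)).trans D.next
  partner k := if k = i ∨ k = D.partner i then k else D.partner k
  partner_partner k := by
    have h := D.partner_partner
    grind
  upper := D.upper
  upper_partner k hk := by
    have h := D.upper_partner k
    grind
  left := D.left
  left_partner k hk := by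
    have h := D.left_partner k
    grind
  free := D.free

/-- The base point of the component of `i`: its point with the least number. -/
noncomputable def base (D : LinkDiagram m) (i : Fin m) : Fin m :=
  open Classical in
  (Finset.univ.filter fun k => D.next.SameCycle i k).min' ⟨i, by simp [Equiv.Perm.SameCycle.refl]⟩

/-- The number of steps from the base point of its component to `i`. -/
noncomputable def steps (D : LinkDiagram m) (i : Fin m) : ℕ :=
  sInf {k : ℕ | (D.next ^ k) (D.base i) = i}

/-- Traverse the components one after the other, in the order of their base points, each one from
its base point on: `i` is met before `j`. -/
def Before (D : LinkDiagram m) (i j : Fin m) : Prop :=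
  D.base i < D.base j ∨ D.base i = D.base j ∧ D.steps i < D.steps j

/-- The passages `i` at which a crossing is met for the first time, but as a lower passage.  The
diagram is descending if there are none. -/
noncomputable def bad (D : LinkDiagram m) : Finset (Fin m) :=
  open Classical in
  Finset.univ.filter fun i => D.partner i ≠ i ∧ D.Before i (D.partner i) ∧ D.upper i = false

/-- The passages through crossings. -/
def passages (D : LinkDiagram m) : Finset (Fin m) :=
  Finset.univ.filter fun i => D.partner i ≠ i

theorem bad_switch (D : LinkDiagram m) {i : Fin m} (hi : i ∈ D.bad) :
    (D.switch i).bad.card < D.bad.card := by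
  classical
  have hi' : D.partner i ≠ i ∧ D.Before i (D.partner i) ∧ D.upper i = false := by
    simpa [bad] using hi
  apply Finset.card_lt_card
  rw [Finset.ssubset_iff_of_subset]
  · refine ⟨i, hi, fun h => ?_⟩
    have h' := (Finset.mem_filter.1 h).2.2.2
    simp [switch, hi'.2.2] at h'
  · intro k hk
    have hk' : D.partner k ≠ k ∧ D.Before k (D.partner k) ∧ (D.switch i).upper k = false :=
      (Finset.mem_filter.1 hk).2
    refine Finset.mem_filter.2 ⟨Finset.mem_univ _, hk'.1, hk'.2.1, ?_⟩
    have ho := hk'.2.2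
    by_cases h1 : k = i
    · rw [h1]; exact hi'.2.2
    by_cases h2 : k = D.partner i
    · exfalso
      have h3 := hk'.2.1
      rw [h2, D.partner_partner] at h3
      rcases h3 with h3 | h3 <;> rcases hi'.2.1 with h4 | h4
      · exact lt_asymm h3 h4
      · exact absurd h3 (by rw [h4.1]; exact lt_irrefl _)
      · exact absurd h4 (by rw [h3.1]; exact lt_irrefl _)
      · exact lt_asymm h3.2 h4.2
    · simpa [switch, h1, h2] using ho

theorem passages_smooth (D : LinkDiagram m) {i : Fin m} (hi : i ∈ D.bad) :
    (D.smooth i).passages.card < D.passages.card := by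
  classical
  have hi' : D.partner i ≠ i := (Finset.mem_filter.1 hi).2.1
  apply Finset.card_lt_card
  rw [Finset.ssubset_iff_of_subset]
  · refine ⟨i, by simpa [passages] using hi', by simp [passages, smooth]⟩
  · intro k hk
    simp only [passages, smooth, Finset.mem_filter, Finset.mem_univ, true_and] at hk ⊢
    grind

/-- The Conway polynomial, in the variable `X`, computed by its skein relation
`∇(L₊) - ∇(L₋) = X * ∇(L₀)`.  A diagram which is not descending is reduced to the one with the first
wrong crossing switched and to the one with this crossing smoothed; a descending diagram presents a
trivial link, for which `∇` is `1` if there is one component and `0` if there are more.  (So for every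
diagram of a link in space this is the value which the axioms of the Conway polynomial force.) -/
noncomputable def conway (D : LinkDiagram m) : ℤ[X] :=
  if h : D.bad.Nonempty then
    conway (D.switch (D.bad.min' h)) +
      C (D.sign (D.bad.min' h)) * X * conway (D.smooth (D.bad.min' h))
  else if D.components = 1 then 1 else 0
termination_by (D.passages.card, D.bad.card)
decreasing_by
  · exact Prod.Lex.right _ (D.bad_switch (D.bad.min'_mem h))
  · exact Prod.Lex.left _ _ (D.passages_smooth (D.bad.min'_mem h))

/-- The coefficient `a₂` of the Conway polynomial. -/
noncomputable def a₂ (D : LinkDiagram m) : ℤ := D.conway.coeff 2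

end LinkDiagram

namespace KnotProjection

/-- A choice of over/under information at each double point. -/
def Resolution (P : KnotProjection) : Type :=
  {o : Fin (2 * P.n) → Bool // ∀ i, o (P.partner i) = !o i}

instance (P : KnotProjection) : Fintype P.Resolution :=
  inferInstanceAs (Fintype {o : Fin (2 * P.n) → Bool // ∀ i, o (P.partner i) = !o i})

/-- The knot diagram with projection `P` and the over/under information `o`. -/
def diagram (P : KnotProjection) (o : P.Resolution) : LinkDiagram (2 * P.n) where
  next := finRotate _
  partner := P.partner
  partner_partner := P.partner_partner
  upper := o.1
  upper_partner i _ := o.2 i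
  left := P.left
  left_partner i _ := P.left_partner i
  free := if P.n = 0 then 1 else 0

/-- The average of `a₂` over the `2 ^ n` knots with projection `P`. -/
noncomputable def averageA₂ (P : KnotProjection) : ℚ :=
  (∑ o : P.Resolution, ((P.diagram o).a₂ : ℚ)) / 2 ^ P.n

/-- The Arnold invariant `J⁺ + 2 St`. -/
noncomputable def arnold (P : KnotProjection) : ℚ := 8 * P.averageA₂

/-- The number of pairs of crossing chords in the chord diagram of `P`.  A pair is listed by the
starting points of its two chords. -/
def crossPairs (P : KnotProjection) : ℕ :=
  (Finset.univ.filter fun q : Fin (2 * P.n) × Fin (2 * P.n) =>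
    q.1 < q.2 ∧ q.2 < P.partner q.1 ∧ P.partner q.1 < P.partner q.2).card

/-- The number of triple chords in the chord diagram of `P`, i.e. of triples of chords any two of
which cross.  A triple is listed by the starting points of its three chords. -/
def tripleChords (P : KnotProjection) : ℕ :=
  (Finset.univ.filter fun q : Fin (2 * P.n) × Fin (2 * P.n) × Fin (2 * P.n) =>
    q.1 < q.2.1 ∧ q.2.1 < q.2.2 ∧ q.2.2 < P.partner q.1 ∧
      P.partner q.1 < P.partner q.2.1 ∧ P.partner q.2.1 < P.partner q.2.2).card

/-- `P'` arises from `P` by removing the passages in `s`, all else being left unchanged.  The base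
point of `P'` need not be that of `P`, so the embedding of the passages is increasing only up to a
rotation. -/
def Removal (P P' : KnotProjection) (s : Set (Fin (2 * P.n))) : Prop :=
  ∃ e : Fin (2 * P'.n) → Fin (2 * P.n),
    (∃ r : ℕ, StrictMono fun i => e ((finRotate (2 * P'.n) ^ r) i)) ∧
    Set.range e = sᶜ ∧
    (∀ i, e (P'.partner i) = P.partner (e i)) ∧
    ∀ i, P'.left i = P.left (e i)

/-- The move `1b` from `P` to `P'`: a `1`-gon, i.e. a region bounded by one edge `i`, is removed
together with its double point. -/
def Move1b (P P' : KnotProjection) : Prop :=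
  ∃ (i : Fin (2 * P.n)) (s : Bool), P.turn (i, s) = (i, s) ∧ Removal P P' {i, finRotate _ i}

/-- The move `s2b` from `P` to `P'`: a strong `2`-gon is removed together with its two double
points.  It is a region bounded by two edges `i`, `j` both of which are walked along the orientation
of `P`, or both against it, in a walk around the region. -/
def MoveS2b (P P' : KnotProjection) : Prop :=
  ∃ (i j : Fin (2 * P.n)) (s : Bool), i ≠ j ∧ P.turn (i, s) = (j, s) ∧ P.turn (j, s) = (i, s) ∧
    Removal P P' {i, finRotate _ i, j, finRotate _ j}

/-- `P` is obtained from the simple closed curve by finitely many inverses of moves `1b` and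
`s2b`. -/
inductive Obtained : KnotProjection → Prop
  | simple (P : KnotProjection) (h : P.n = 0) : Obtained P
  | inv1b (P P' : KnotProjection) (h : Obtained P') (hm : Move1b P P') : Obtained P
  | invS2b (P P' : KnotProjection) (h : Obtained P') (hm : MoveS2b P P') : Obtained P

end KnotProjection

/-- The set `𝒮` of the knot projections obtained from the simple closed curve by finitely many
inverses of moves `1b` and `s2b`. -/
def setS : Set KnotProjection := {P | P.Obtained}

/-! The sphere enters only through homology. Since the curve is connected, Euler characteristic `2`
means that every cycle of edges bounds a combination of regions
(`CurveDiagram.sphere_iff_cyclesBound`). Over `ℚ` this makes a loop and a cycle disjoint from it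
meet algebraically zero times (`CyclesBound.loop_sum`). Over `ZMod 2` it gives sets of regions with
prescribed boundary, and parity arguments.

First inclusion. The skein recursion yields the Polyak–Viro formula
(`LinkDiagram.conway_coeff_two`): `a₂` is the sum of the products of crossing signs over those
crossing pairs of chords which show one prescribed over/under pattern. A given pair shows it in a
quarter of all resolutions, so the average is proportional to `linkSum`, which depends on the
projection alone (`arnold_eq`). The signs of the chords crossing a given chord add up to zero
(`CyclesBound.sum_sgn`), hence `linkSum` does not depend on the base point. With the base point at
the polygon to be removed, invariance is visible: the chord of a `1`-gon crosses nothing, and the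
two chords of a strong `2`-gon cross the same chords with opposite signs. For the simple closed
curve the sum is empty.

Second inclusion. Removing chords creates no triple chord, so by induction on the number of double
points it suffices to find a `1`-gon or a strong `2`-gon (`reducible_of_tripleFree`). A simple loop
of the curve bounds a disk. More generally, consider disks bounded by a simple arc which is closed
by a double point or by one more edge, coherently oriented. If the arc has more than one edge, the
absence of triple chords forces a strand through the disk which joins two neighbouring passages of
the arc in the backward direction (`Disk.exists_strand`). Either the strand contains a loop, or
together with the edge between its ends it bounds a disk of the same kind; both are smaller
(`Disk.exists_smaller`). A smallest disk therefore has an arc of one edge, which gives the polygon.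

Third inclusion. Two chords of a triple chord already cross. -/

section Rotation

theorem val_finRotate {N : ℕ} (x : Fin N) :
    (finRotate N x : ℕ) = if (x : ℕ) + 1 = N then 0 else (x : ℕ) + 1 := by
  cases N with
  | zero => exact x.elim0
  | succ k =>
    rw [coe_finRotate]
    simp only [Fin.ext_iff, Fin.val_last, Nat.add_right_cancel_iff]

theorem eq_of_finRotate_invariant {N : ℕ} {α : Type*} {f : Fin N → α}
    (hf : ∀ x, f (finRotate N x) = f x) (x y : Fin N) : f x = f y := by
  have key : ∀ k (hk : k < N), f ⟨k, hk⟩ = f ⟨0, by omega⟩ := by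
    intro k
    induction k with
    | zero => intro _; rfl
    | succ k ih =>
      intro hk
      rw [← ih (by omega), ← hf ⟨k, by omega⟩]
      congr 1
      ext
      rw [val_finRotate]
      simp only
      rw [if_neg (by omega)]
  have hx := key x x.2
  have hy := key y y.2
  exact hx.trans hy.symm

end Rotation

/-! ### Homology of the cell complex formed by double points, edges and regions. -/

namespace CurveDiagram

variable (D : CurveDiagram)

/-- A function on the regions, given on the sides of the edges. -/
def IsRegionFun {α : Type*} (h : Fin (2 * D.n) × Bool → α) : Prop := ∀ q, h (D.turn q) = h q

/-- The functions on the edges which are closed as `1`-chains. -/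
def IsCycle {K : Type*} [Add K] (z : Fin (2 * D.n) → K) : Prop :=
  ∀ y, z ((finRotate _).symm y) + z ((finRotate _).symm (D.partner y)) = z y + z (D.partner y)

/-- Every cycle is the boundary of a combination of regions. -/
def CyclesBound (K : Type*) [AddGroup K] : Prop :=
  ∀ z : Fin (2 * D.n) → K, D.IsCycle z →
    ∃ h : Fin (2 * D.n) × Bool → K, D.IsRegionFun h ∧ ∀ e, z e = h (e, true) - h (e, false)

variable {D}

theorem IsRegionFun.left_in {α : Type*} {h : Fin (2 * D.n) × Bool → α} (hh : D.IsRegionFun h)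
    {y : Fin (2 * D.n)} (hy : D.left y = true) :
    h ((finRotate _).symm y, true) = h (D.partner y, true) := by
  rw [← hh ((finRotate _).symm y, true)]
  simp only [turn, hy, Equiv.apply_symm_apply, if_true]

theorem IsRegionFun.left_out {α : Type*} {h : Fin (2 * D.n) × Bool → α} (hh : D.IsRegionFun h)
    {y : Fin (2 * D.n)} (hy : D.left y = true) :
    h (y, false) = h ((finRotate _).symm (D.partner y), false) := by
  rw [← hh (y, false)]
  simp only [turn, hy, if_true]

theorem IsRegionFun.right_in {α : Type*} {h : Fin (2 * D.n) × Bool → α} (hh : D.IsRegionFun h)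
    {y : Fin (2 * D.n)} (hy : D.left y = false) :
    h ((finRotate _).symm y, true) = h ((finRotate _).symm (D.partner y), false) := by
  rw [← hh ((finRotate _).symm y, true)]
  simp only [turn, hy, Equiv.apply_symm_apply, if_false, Bool.false_eq_true]

theorem IsRegionFun.right_out {α : Type*} {h : Fin (2 * D.n) × Bool → α} (hh : D.IsRegionFun h)
    {y : Fin (2 * D.n)} (hy : D.left y = false) :
    h (y, false) = h (D.partner y, true) := by
  rw [← hh (y, false)]
  simp only [turn, hy, if_false, Bool.false_eq_true]

/-- The four relations above are all that there is to a function on the regions. -/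
theorem isRegionFun_of {α : Type*} {h : Fin (2 * D.n) × Bool → α}
    (h1 : ∀ y, D.left y = true → h ((finRotate _).symm y, true) = h (D.partner y, true))
    (h2 : ∀ y, D.left y = true → h (y, false) = h ((finRotate _).symm (D.partner y), false))
    (h3 : ∀ y, D.left y = false →
      h ((finRotate _).symm y, true) = h ((finRotate _).symm (D.partner y), false))
    (h4 : ∀ y, D.left y = false → h (y, false) = h (D.partner y, true)) : D.IsRegionFun h := by
  rintro ⟨e, s⟩
  cases s
  · cases hl : D.left e
    · simp only [turn, hl, h4 e hl, if_false, Bool.false_eq_true]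
    · simp only [turn, hl, h2 e hl, if_true]
  · cases hl : D.left (finRotate _ e)
    · have := h3 _ hl
      rw [Equiv.symm_apply_apply] at this
      simp only [turn, hl, this, if_false, Bool.false_eq_true]
    · have := h1 _ hl
      rw [Equiv.symm_apply_apply] at this
      simp only [turn, hl, this, if_true]

/-- A function on the regions which never changes across an edge is constant. -/
theorem IsRegionFun.eq_of_flat {α : Type*} {h : Fin (2 * D.n) × Bool → α} (hh : D.IsRegionFun h)
    (hf : ∀ e, h (e, true) = h (e, false)) (q r : Fin (2 * D.n) × Bool) : h q = h r := by
  have hs : ∀ e s, h (e, s) = h (e, true) := by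
    rintro e (_ | _)
    · exact (hf e).symm
    · rfl
  have key : ∀ x, h (finRotate _ x, true) = h (x, true) := by
    intro x
    obtain ⟨y, rfl⟩ : ∃ y, x = (finRotate _).symm y := ⟨finRotate _ x, (Equiv.symm_apply_apply _ _).symm⟩
    rw [Equiv.apply_symm_apply]
    cases hl : D.left y
    · have hl' : D.left (D.partner y) = true := by rw [D.left_partner, hl]; rfl
      have b := hh.left_in hl'
      rw [D.partner_partner] at b
      rw [hh.right_in hl, ← hf, b]
    · have hl' : D.left (D.partner y) = false := by rw [D.left_partner, hl]; rfl
      have b := hh.right_out hl'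
      rw [D.partner_partner] at b
      rw [hh.left_in hl, ← b, hf]
  obtain ⟨a, s⟩ := q
  obtain ⟨b, t⟩ := r
  rw [hs a s, hs b t]
  exact eq_of_finRotate_invariant (f := fun x => h (x, true)) key a b

/-- The region of a side of an edge. -/
def region (D : CurveDiagram) (q : Fin (2 * D.n) × Bool) : D.Region := Quot.mk _ q

theorem isRegionFun_comp_region {α : Type*} (φ : D.Region → α) :
    D.IsRegionFun fun q => φ (D.region q) := fun q =>
  congrArg φ (Quot.sound rfl : D.region q = D.region (D.turn q)).symm

theorem exists_eq_comp_region {α : Type*} (h : Fin (2 * D.n) × Bool → α) (hh : D.IsRegionFun h) :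
    ∃ φ : D.Region → α, ∀ q, φ (D.region q) = h q :=
  ⟨Quot.lift h fun a b hab => by rw [← hab, hh], fun _ => rfl⟩

section Homology

variable (D) (K : Type*) [Field K]

instance : Finite D.Region := inferInstanceAs (Finite (Quot _))

/-- The coboundary of a function on the regions. -/
def regionDiff : (D.Region → K) →ₗ[K] (Fin (2 * D.n) → K) where
  toFun φ e := φ (D.region (e, true)) - φ (D.region (e, false))
  map_add' φ ψ := by ext e; simp only [Pi.add_apply]; ring
  map_smul' c φ := by ext e; simp only [Pi.smul_apply, smul_eq_mul, RingHom.id_apply]; ring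

/-- The space of cycles. -/
def cycleSpace : Submodule K (Fin (2 * D.n) → K) where
  carrier := {z | D.IsCycle z}
  add_mem' {a b} ha hb y := by
    have h1 := ha y
    have h2 := hb y
    simp only [Pi.add_apply]
    linear_combination h1 + h2
  zero_mem' y := by simp
  smul_mem' c a ha y := by
    have h1 := ha y
    simp only [Pi.smul_apply, smul_eq_mul]
    linear_combination c * h1

variable {K} in
theorem IsRegionFun.isCycle {h : Fin (2 * D.n) × Bool → K} (hh : D.IsRegionFun h) :
    D.IsCycle fun e => h (e, true) - h (e, false) := by
  have key : ∀ y, D.left y = true →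
      h ((finRotate _).symm y, true) - h ((finRotate _).symm y, false) +
      (h ((finRotate _).symm (D.partner y), true) - h ((finRotate _).symm (D.partner y), false)) =
      h (y, true) - h (y, false) + (h (D.partner y, true) - h (D.partner y, false)) := by
    intro y hy
    have hl' : D.left (D.partner y) = false := by rw [D.left_partner, hy]; rfl
    have a := hh.left_in hy
    have b := hh.left_out hy
    have c := hh.right_in hl'
    have d := hh.right_out hl'
    rw [D.partner_partner] at c d
    rw [a, b, c, d]
    ring
  intro y
  cases hl : D.left y
  · have hl' : D.left (D.partner y) = true := by rw [D.left_partner, hl]; rfl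
    have := key _ hl'
    rw [D.partner_partner] at this
    simp only
    linear_combination this
  · exact key y hl

theorem range_regionDiff_le : LinearMap.range (D.regionDiff K) ≤ D.cycleSpace K := by
  rintro _ ⟨φ, rfl⟩
  exact (isRegionFun_comp_region φ).isCycle D

theorem cyclesBound_iff : D.CyclesBound K ↔ LinearMap.range (D.regionDiff K) = D.cycleSpace K := by
  rw [le_antisymm_iff]
  constructor
  · intro h
    refine ⟨D.range_regionDiff_le K, fun z hz => ?_⟩
    obtain ⟨g, hg, hz⟩ := h z hz
    obtain ⟨φ, hφ⟩ := exists_eq_comp_region g hg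
    exact ⟨φ, by ext e; simp [regionDiff, hφ, hz]⟩
  · rintro ⟨-, h⟩ z hz
    obtain ⟨φ, rfl⟩ := h hz
    exact ⟨fun q => φ (D.region q), isRegionFun_comp_region φ, fun e => rfl⟩

/-- The curve is connected, so a function that changes across no edge is constant. Without double
points there would be no edge side, and the kernel would be zero. -/
theorem finrank_ker_regionDiff (hn : D.n ≠ 0) :
    Module.finrank K (LinearMap.ker (D.regionDiff K)) = 1 := by
  have h0 : 0 < 2 * D.n := by omega
  refine finrank_eq_one ⟨fun _ => 1, ?_⟩ ?_ ?_
  · ext e; simp [regionDiff]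
  · intro h
    have := congrFun (Subtype.ext_iff.1 h) (D.region (⟨0, h0⟩, true))
    exact one_ne_zero this
  · rintro ⟨φ, hφ⟩
    have hh := isRegionFun_comp_region φ
    refine ⟨φ (D.region (⟨0, h0⟩, true)), Subtype.ext ?_⟩
    ext r
    induction r using Quot.inductionOn with
    | _ q =>
      have := hh.eq_of_flat (fun e => sub_eq_zero.1 (congrFun hφ e)) (⟨0, h0⟩, true) q
      exact (mul_one _).trans this

theorem finrank_range_regionDiff (hn : D.n ≠ 0) :
    Module.finrank K (LinearMap.range (D.regionDiff K)) + 1 = Nat.card D.Region := by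
  have := Fintype.ofFinite D.Region
  have h := (D.regionDiff K).finrank_range_add_finrank_ker
  rw [D.finrank_ker_regionDiff K hn, Module.finrank_fintype_fun_eq_card] at h
  rw [h, Nat.card_eq_fintype_card]

/-- One passage through each double point. -/
abbrev Vertex : Type := {i : Fin (2 * D.n) // i < D.partner i}

theorem card_vertex : Fintype.card D.Vertex = D.n := by
  classical
  have h1 : Fintype.card D.Vertex = (Finset.univ.filter fun i => i < D.partner i).card :=
    Fintype.card_subtype _
  have h2 : (Finset.univ.filter fun i => i < D.partner i).card =
      (Finset.univ.filter fun i => ¬ i < D.partner i).card := by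
    refine Finset.card_bij (fun i _ => D.partner i) ?_ ?_ ?_
    · intro i hi
      simp only [Finset.mem_filter, Finset.mem_univ, true_and, D.partner_partner] at hi ⊢
      exact not_lt.2 hi.le
    · intro i _ j _ hij
      rw [← D.partner_partner i, hij, D.partner_partner]
    · intro i hi
      simp only [Finset.mem_filter, Finset.mem_univ, true_and, not_lt] at hi
      refine ⟨D.partner i, ?_, D.partner_partner i⟩
      simp only [Finset.mem_filter, Finset.mem_univ, true_and, D.partner_partner]
      exact lt_of_le_of_ne hi (D.partner_ne i)
  have h3 := Finset.card_filter_add_card_filter_not (s := (Finset.univ : Finset (Fin (2 * D.n))))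
    (fun i => i < D.partner i)
  rw [Finset.card_univ, Fintype.card_fin] at h3
  omega

/-- The vertex of a passage. -/
def toVertex (i : Fin (2 * D.n)) : D.Vertex :=
  if h : i < D.partner i then ⟨i, h⟩ else
    ⟨D.partner i, by
      rw [D.partner_partner]; exact lt_of_le_of_ne (not_lt.1 h) (D.partner_ne i)⟩

/-- The incidence matrix of double points and edges. -/
def incidence : Matrix D.Vertex (Fin (2 * D.n)) K := fun v e =>
  ((if finRotate _ e = v.1 then 1 else 0) + (if finRotate _ e = D.partner v.1 then 1 else 0)) -
    ((if e = v.1 then 1 else 0) + (if e = D.partner v.1 then 1 else 0))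

variable {D} in
theorem toVertex_coe (v : D.Vertex) : D.toVertex v.1 = v := by
  simp [toVertex, v.2]

variable {D} in
theorem toVertex_partner (i : Fin (2 * D.n)) : D.toVertex (D.partner i) = D.toVertex i := by
  unfold toVertex
  rcases lt_or_gt_of_ne (D.partner_ne i) with h | h
  · have h' : ¬ i < D.partner i := not_lt.2 h.le
    simp [D.partner_partner, h, h']
  · have h' : ¬ D.partner i < i := not_lt.2 h.le
    simp [D.partner_partner, h, h']

theorem sum_vertex (g : D.Vertex → K) (x : Fin (2 * D.n)) :
    ∑ v : D.Vertex, g v * ((if x = v.1 then 1 else 0) + (if x = D.partner v.1 then 1 else 0)) =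
      g (D.toVertex x) := by
  rw [Finset.sum_eq_single (D.toVertex x)]
  · rcases lt_or_ge x (D.partner x) with h | h
    · have : (D.toVertex x).1 = x := by simp only [toVertex, dif_pos h]
      rw [this, if_pos rfl, if_neg (D.partner_ne x).symm, add_zero, mul_one]
    · have : (D.toVertex x).1 = D.partner x := by simp only [toVertex, dif_neg (not_lt.2 h)]
      rw [this, if_neg (D.partner_ne x).symm, D.partner_partner, if_pos rfl, zero_add, mul_one]
  · intro v _ hv
    rw [if_neg, if_neg]
    · simp
    · rintro rfl
      exact hv (by rw [toVertex_partner, toVertex_coe])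
    · rintro rfl
      exact hv (toVertex_coe v).symm
  · simp

theorem incidence_vecMul (g : D.Vertex → K) (e : Fin (2 * D.n)) :
    (D.incidence K).transpose.mulVec g e =
      g (D.toVertex (finRotate _ e)) - g (D.toVertex e) := by
  rw [← D.sum_vertex K g, ← D.sum_vertex K g, ← Finset.sum_sub_distrib]
  simp only [Matrix.mulVec, dotProduct, Matrix.transpose_apply, incidence]
  exact Finset.sum_congr rfl fun v _ => by ring

theorem incidence_mulVec (z : Fin (2 * D.n) → K) (v : D.Vertex) :
    (D.incidence K).mulVec z v =
      z ((finRotate _).symm v.1) + z ((finRotate _).symm (D.partner v.1)) -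
        (z v.1 + z (D.partner v.1)) := by
  simp only [Matrix.mulVec, dotProduct, incidence, ← Equiv.eq_symm_apply, sub_mul, add_mul,
    Finset.sum_sub_distrib, Finset.sum_add_distrib, ite_mul, one_mul, zero_mul,
    Finset.sum_ite_eq', Finset.mem_univ, if_true]

theorem ker_incidence : LinearMap.ker (D.incidence K).mulVecLin = D.cycleSpace K := by
  ext z
  rw [LinearMap.mem_ker, Matrix.mulVecLin_apply]
  constructor
  · intro h y
    have hy := congrFun h (D.toVertex y)
    rw [incidence_mulVec, Pi.zero_apply, sub_eq_zero] at hy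
    unfold toVertex at hy
    split_ifs at hy
    · exact hy
    · simp only [D.partner_partner] at hy
      rw [add_comm, hy, add_comm]
  · intro h
    ext v
    rw [incidence_mulVec, Pi.zero_apply, sub_eq_zero]
    exact h v.1

/-- The graph is connected, so the transposed incidence matrix has only the constants in its kernel.
The rank is thus `n - 1`, which leaves `2n - (n - 1)` dimensions for the cycles. -/
theorem finrank_cycleSpace (hn : D.n ≠ 0) :
    Module.finrank K (D.cycleSpace K) = D.n + 1 := by
  have h0 : 0 < 2 * D.n := by omega
  have hk : Module.finrank K (LinearMap.ker (D.incidence K).transpose.mulVecLin) = 1 := by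
    refine finrank_eq_one ⟨fun _ => 1, ?_⟩ ?_ ?_
    · rw [LinearMap.mem_ker, Matrix.mulVecLin_apply]
      ext e
      simp [incidence_vecMul]
    · intro h
      have := congrFun (Subtype.ext_iff.1 h) (D.toVertex ⟨0, h0⟩)
      simp at this
    · rintro ⟨g, hg⟩
      rw [LinearMap.mem_ker, Matrix.mulVecLin_apply] at hg
      have hc : ∀ x y, g (D.toVertex x) = g (D.toVertex y) :=
        eq_of_finRotate_invariant (f := fun x => g (D.toVertex x)) fun x => by
          have := congrFun hg x
          rwa [incidence_vecMul, Pi.zero_apply, sub_eq_zero] at this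
      refine ⟨g (D.toVertex ⟨0, h0⟩), Subtype.ext ?_⟩
      ext v
      have := hc ⟨0, h0⟩ v.1
      rw [toVertex_coe] at this
      simpa using this
  have h1 := (D.incidence K).transpose.mulVecLin.finrank_range_add_finrank_ker
  have h2 := (D.incidence K).mulVecLin.finrank_range_add_finrank_ker
  have h3 := (D.incidence K).rank_transpose
  rw [Matrix.rank, Matrix.rank] at h3
  rw [hk, Module.finrank_fintype_fun_eq_card, card_vertex] at h1
  rw [ker_incidence, Module.finrank_fintype_fun_eq_card, Fintype.card_fin] at h2
  omega

/-- The sphere is characterized by the vanishing of the first homology. -/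
theorem sphere_iff_cyclesBound (hn : D.n ≠ 0) :
    (D.n : ℤ) - (2 * D.n : ℕ) + Nat.card D.Region = 2 ↔ D.CyclesBound K := by
  rw [cyclesBound_iff]
  have h1 := D.finrank_range_regionDiff K hn
  have h2 := D.finrank_cycleSpace K hn
  constructor
  · intro h
    refine Submodule.eq_of_le_of_finrank_eq (D.range_regionDiff_le K) ?_
    omega
  · intro h
    rw [h] at h1
    omega

end Homology

end CurveDiagram

theorem KnotProjection.cyclesBound (P : KnotProjection) (hn : P.n ≠ 0) (K : Type*) [Field K] :
    P.CyclesBound K :=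
  (P.sphere_iff_cyclesBound K hn).1 (P.sphere hn)

/-! ### Cyclic positions relative to a base point. -/

section Position

variable {N : ℕ}

/-- The number of steps from `b` to `x` along the circle. -/
def pos (b x : Fin N) : ℕ := if (b : ℕ) ≤ x then (x : ℕ) - b else x + N - b

theorem pos_lt (b x : Fin N) : pos b x < N := by
  unfold pos; split_ifs <;> omega

theorem pos_self (b : Fin N) : pos b b = 0 := by
  simp [pos]

theorem pos_inj {b x y : Fin N} : pos b x = pos b y ↔ x = y := by
  constructor
  · unfold pos
    intro h
    ext
    split_ifs at h <;> omega
  · rintro rfl; rfl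

theorem pos_eq_zero {b x : Fin N} : pos b x = 0 ↔ x = b := by
  rw [← pos_self b, pos_inj]

theorem exists_pos_eq (b : Fin N) {t : ℕ} (ht : t < N) : ∃ x, pos b x = t := by
  by_cases h : (b : ℕ) + t < N
  · exact ⟨⟨b + t, h⟩, by simp [pos]⟩
  · refine ⟨⟨b + t - N, by omega⟩, ?_⟩
    unfold pos
    simp only
    split_ifs <;> omega

theorem pos_change (b c x : Fin N) :
    pos c x = if pos b c ≤ pos b x then pos b x - pos b c else pos b x + N - pos b c := by
  unfold pos
  split_ifs <;> omega

theorem pos_finRotate (b x : Fin N) :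
    pos b (finRotate N x) = if pos b x + 1 = N then 0 else pos b x + 1 := by
  have h := val_finRotate x
  unfold pos
  rw [h]
  split_ifs at * <;> omega

theorem pos_finRotate_symm (b x : Fin N) :
    pos b ((finRotate N).symm x) = if pos b x = 0 then N - 1 else pos b x - 1 := by
  have h := pos_finRotate b ((finRotate N).symm x)
  rw [Equiv.apply_symm_apply] at h
  have h1 := pos_lt b ((finRotate N).symm x)
  split_ifs at * <;> omega

theorem pos_finRotate_base (b x : Fin N) :
    pos (finRotate N b) x = if pos b x = 0 then N - 1 else pos b x - 1 := by
  have h1 := pos_finRotate b b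
  have h2 := pos_lt b x
  rw [pos_self] at h1
  rw [pos_change b, h1]
  split_ifs <;> omega

theorem eq_of_pos_succ {b x y : Fin N} (h : pos b y = pos b x + 1) : y = finRotate N x := by
  rw [← pos_inj (b := b), pos_finRotate, h, if_neg]
  have := pos_lt b y
  omega

theorem eq_of_arc_invariant {α : Type*} {f : Fin N → α} {b : Fin N} {s t : ℕ}
    (hf : ∀ x, s ≤ pos b x → pos b x + 1 ≤ t → pos b x + 1 < N → f (finRotate N x) = f x)
    {x y : Fin N} (hx : s ≤ pos b x) (hx' : pos b x ≤ t) (hy : s ≤ pos b y) (hy' : pos b y ≤ t) :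
    f x = f y := by
  have key : ∀ k, ∀ x y : Fin N, s ≤ pos b x → pos b y = pos b x + k → pos b y ≤ t →
      f y = f x := by
    intro k
    induction k with
    | zero =>
      intro x y _ h _
      rw [pos_inj.1 h]
    | succ k ih =>
      intro x y hx h ht
      have hN := pos_lt b y
      obtain ⟨w, hw⟩ := exists_pos_eq b (t := pos b x + k) (by omega)
      have hyw : y = finRotate N w := eq_of_pos_succ (b := b) (by omega)
      rw [hyw, hf w (by omega) (by omega) (by omega)]
      exact ih x w hx hw (by omega)
  rcases le_total (pos b x) (pos b y) with h | h
  · exact (key (pos b y - pos b x) x y hx (by omega) hy').symm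
  · exact key (pos b x - pos b y) y x hy (by omega) hx'

/-- `G` lives on the edges; the summand at a passage is the jump of `G` there. Only passages
strictly after `j` count, since the walk starts on the edge leaving `j`. -/
theorem sum_arc_telescope {K : Type*} [AddCommGroup K] (G : Fin N → K) (j : Fin N) (m : ℕ)
    (x : Fin N) (hx : pos j x = m) :
    ∑ y, (if 0 < pos j y ∧ pos j y ≤ m then G ((finRotate N).symm y) - G y else 0) =
      G j - G x := by
  induction m generalizing x with
  | zero =>
    rw [pos_eq_zero.1 hx, sub_self]
    exact Finset.sum_eq_zero fun y _ => if_neg (by omega)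
  | succ m ih =>
    have hN := pos_lt j x
    obtain ⟨w, hw⟩ := exists_pos_eq j (t := m) (by omega)
    have hxw : x = finRotate N w := eq_of_pos_succ (b := j) (by omega)
    have hs : ∀ y, (if 0 < pos j y ∧ pos j y ≤ m + 1 then G ((finRotate N).symm y) - G y else 0) =
        (if 0 < pos j y ∧ pos j y ≤ m then G ((finRotate N).symm y) - G y else 0) +
        (if y = x then G ((finRotate N).symm y) - G y else 0) := by
      intro y
      by_cases hyx : y = x
      · subst hyx
        rw [if_pos (by omega), if_neg (by omega), if_pos rfl, zero_add]
      · have : pos j y ≠ m + 1 := fun h => hyx (pos_inj.1 (h.trans hx.symm))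
        rw [if_neg hyx, add_zero]
        congr 1
        exact propext (by omega)
    rw [Finset.sum_congr rfl fun y _ => hs y, Finset.sum_add_distrib, ih w hw,
      Finset.sum_ite_eq' , if_pos (Finset.mem_univ _), hxw, Equiv.symm_apply_apply]
    abel

end Position

/-! ### Intersection numbers and the independence of `linkSum` of the base point. -/

namespace CurveDiagram

variable {D : CurveDiagram}

theorem partner_injective (D : CurveDiagram) : Function.Injective D.partner :=
  Function.LeftInverse.injective D.partner_partner

theorem left_partner_of_true {y : Fin (2 * D.n)} (h : D.left y = true) :
    D.left (D.partner y) = false := by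
  rw [D.left_partner, h]; rfl

theorem left_partner_of_false {y : Fin (2 * D.n)} (h : D.left y = false) :
    D.left (D.partner y) = true := by
  rw [D.left_partner, h]; rfl

section Loop

variable {K : Type*} [Ring K]

/-- The part of the curve between the two passages through a double point, as a chain. -/
theorem isCycle_arc (D : CurveDiagram) (b : Fin (2 * D.n)) :
    D.IsCycle fun e => if pos b e < pos b (D.partner b) then (1 : K) else 0 := by
  have hne : pos b (D.partner b) ≠ 0 := fun h => D.partner_ne b (pos_eq_zero.1 h)
  have hlt := pos_lt b (D.partner b)
  have gen : ∀ y, y ≠ b → y ≠ D.partner b →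
      (if pos b ((finRotate _).symm y) < pos b (D.partner b) then (1 : K) else 0) =
      if pos b y < pos b (D.partner b) then (1 : K) else 0 := by
    intro y h1 h2
    have h1' : pos b y ≠ 0 := fun h => h1 (pos_eq_zero.1 h)
    have h2' : pos b y ≠ pos b (D.partner b) := fun h => h2 (pos_inj.1 h)
    rw [pos_finRotate_symm, if_neg h1']
    congr 1
    exact propext (by omega)
  have hb : (if pos b ((finRotate _).symm b) < pos b (D.partner b) then (1 : K) else 0) = 0 := by
    rw [pos_finRotate_symm, pos_self, if_pos rfl, if_neg (by omega)]
  have hp : (if pos b ((finRotate _).symm (D.partner b)) < pos b (D.partner b)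
      then (1 : K) else 0) = 1 := by
    rw [pos_finRotate_symm, if_neg hne, if_pos (by omega)]
  have hb' : (if pos b b < pos b (D.partner b) then (1 : K) else 0) = 1 := by
    rw [pos_self, if_pos (by omega)]
  have hp' : (if pos b (D.partner b) < pos b (D.partner b) then (1 : K) else 0) = 0 :=
    if_neg (lt_irrefl _)
  intro y
  simp only
  by_cases h1 : y = b
  · subst h1
    rw [hb, hp, hb', hp']
    abel
  by_cases h2 : y = D.partner b
  · subst h2
    rw [D.partner_partner, hb, hp, hb', hp']
    abel
  rw [gen y h1 h2, gen (D.partner y) (fun h => h2 (by rw [← h, D.partner_partner]))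
    (fun h => h1 (D.partner_injective h))]

/-- How a function on the regions changes on the left-hand side of the curve. -/
theorem IsRegionFun.sub_eq {h : Fin (2 * D.n) × Bool → K} (hh : D.IsRegionFun h)
    {z : Fin (2 * D.n) → K} (hz : ∀ e, z e = h (e, true) - h (e, false)) (y : Fin (2 * D.n)) :
    h ((finRotate _).symm y, true) - h (y, true) =
      if D.left y then z (D.partner y) else - z ((finRotate _).symm (D.partner y)) := by
  cases hl : D.left y
  · have := hh.left_in (left_partner_of_false hl)
    rw [D.partner_partner] at this
    rw [hh.right_in hl, hz ((finRotate _).symm _), ← this]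
    simp only [neg_sub, Bool.false_eq_true, if_false]
  · have := hh.right_out (left_partner_of_true hl)
    rw [D.partner_partner] at this
    rw [hh.left_in hl, hz, ← this]
    simp only [if_true]

/-- A loop of the curve meets a cycle disjoint from it algebraically zero times. -/
theorem CyclesBound.loop_sum (hD : D.CyclesBound K) {z : Fin (2 * D.n) → K} (hz : D.IsCycle z)
    (j : Fin (2 * D.n)) (hzj : ∀ e, pos j e < pos j (D.partner j) → z e = 0) :
    ∑ y, (if 0 < pos j y ∧ pos j y < pos j (D.partner j) then
      (if D.left y then z (D.partner y) else - z ((finRotate _).symm (D.partner y))) else 0) =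
      0 := by
  obtain ⟨h, hh, hzh⟩ := hD z hz
  have hne : pos j (D.partner j) ≠ 0 := fun h => D.partner_ne j (pos_eq_zero.1 h)
  have hx : pos j ((finRotate _).symm (D.partner j)) = pos j (D.partner j) - 1 := by
    rw [pos_finRotate_symm, if_neg hne]
  have key := sum_arc_telescope (fun e => h (e, true)) j _ _ hx
  have e1 : h (j, true) = h (j, false) := by
    rw [← sub_eq_zero, ← hzh]; exact hzj _ (by rw [pos_self]; omega)
  have e2 : h ((finRotate _).symm (D.partner j), true) =
      h ((finRotate _).symm (D.partner j), false) := by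
    rw [← sub_eq_zero, ← hzh]; exact hzj _ (by omega)
  -- The first and the last edge of the loop are adjacent at its double point. Depending on the
  -- turning direction they share a corner on their left or on their right side; in the latter case
  -- `h` is carried over by its flatness along the loop.
  have e3 : h (j, true) = h ((finRotate _).symm (D.partner j), true) := by
    cases hl : D.left j
    · have := hh.left_in (left_partner_of_false hl)
      rw [D.partner_partner] at this
      exact this.symm
    · rw [e1, e2]
      exact hh.left_out hl
  rw [e3, sub_self] at key
  rw [← key]
  refine Finset.sum_congr rfl fun y _ => ?_
  rw [← hh.sub_eq hzh]
  congr 1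
  exact propext (by omega)

end Loop

section Sign

/-- The sign of a passage. -/
def sgn (D : CurveDiagram) (i : Fin (2 * D.n)) : ℚ := if D.left i then 1 else -1

theorem sgn_partner (i : Fin (2 * D.n)) : D.sgn (D.partner i) = - D.sgn i := by
  unfold sgn
  rw [D.left_partner]
  cases D.left i <;> simp

/-- The chords of `i` and `l` cross, and in the order of `π` their ends are met in the order
`i`, `l`, `partner i`, `partner l`. -/
abbrev Linked (D : CurveDiagram) (π : Fin (2 * D.n) → ℕ) (i l : Fin (2 * D.n)) : Prop :=
  π i < π l ∧ π l < π (D.partner i) ∧ π (D.partner i) < π (D.partner l)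

/-- The sum of the products of signs over the pairs of crossing chords. -/
def linkSum (D : CurveDiagram) (π : Fin (2 * D.n) → ℕ) : ℚ :=
  ∑ i, ∑ l, if D.Linked π i l then D.sgn i * D.sgn l else 0

/-- The double point of `b` cuts the curve into two loops without common edge. Their remaining
intersections are exactly the chords crossing that of `b`, so the signed count is the intersection
number of the loops and vanishes. -/
theorem CyclesBound.sum_sgn (hD : D.CyclesBound ℚ) (b : Fin (2 * D.n)) :
    ∑ l, (if 0 < pos b l ∧ pos b l < pos b (D.partner b) ∧
      pos b (D.partner b) < pos b (D.partner l) then D.sgn l else 0) = 0 := by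
  have hne : pos b (D.partner b) ≠ 0 := fun h => D.partner_ne b (pos_eq_zero.1 h)
  have hlt := pos_lt b (D.partner b)
  have hpos : ∀ e, pos (D.partner b) e = if pos b (D.partner b) ≤ pos b e then
      pos b e - pos b (D.partner b) else pos b e + 2 * D.n - pos b (D.partner b) :=
    fun e => pos_change b _ e
  have key := hD.loop_sum (D.isCycle_arc b) (D.partner b) (fun e he => by
    rw [D.partner_partner, hpos, hpos, pos_self] at he
    have := pos_lt b e
    refine if_neg ?_
    split_ifs at he <;> omega)
  rw [← neg_eq_zero, ← Finset.sum_neg_distrib]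
  refine Eq.trans ?_ key
  have hinv : Function.Involutive D.partner := D.partner_partner
  -- `loop_sum` runs over the passages on the loop from `partner b` to `b`, the claim over their
  -- partners on the other loop.
  rw [← Equiv.sum_comp hinv.toPerm]
  refine Finset.sum_congr rfl fun y _ => ?_
  rw [Function.Involutive.coe_toPerm, D.partner_partner, D.partner_partner, sgn_partner, hpos, hpos, pos_self]
  by_cases hy : pos b (D.partner b) < pos b y
  · have h3 := pos_lt b y
    have hy0 : D.partner y ≠ b := by
      rintro h
      rw [← h, D.partner_partner] at hy
      exact lt_irrefl _ hy
    have hy0' : pos b (D.partner y) ≠ 0 := fun h => hy0 (pos_eq_zero.1 h)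
    have hy1 : pos b (D.partner y) ≠ pos b (D.partner b) := fun h => by
      have := D.partner_injective (pos_inj.1 h)
      rw [this, pos_self] at hy
      omega
    rw [if_pos (c := 0 < _ ∧ _ < _)]
    · have hp := pos_finRotate_symm b (D.partner y)
      rw [if_neg hy0'] at hp
      by_cases h4 : pos b (D.partner y) < pos b (D.partner b)
      · rw [if_pos (by omega), if_pos h4, hp, if_pos (c := pos b (D.partner y) - 1 < _) (by omega)]
        unfold sgn
        split_ifs <;> simp
      · rw [if_neg (by omega), if_neg h4, hp, if_neg (c := pos b (D.partner y) - 1 < _) (by omega)]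
        simp
    · rw [if_pos hy.le]
      split_ifs <;> omega
  · rw [if_neg (by omega), if_neg, neg_zero]
    split_ifs <;> omega

/-- Moving the base point past `b` turns `b` from the first into the last passage, so only pairs
containing its chord are listed differently. Before and after, these pairs contribute a multiple of
the sum in `sum_sgn`, which is zero. -/
theorem CyclesBound.linkSum_finRotate (hD : D.CyclesBound ℚ) (b : Fin (2 * D.n)) :
    D.linkSum (pos (finRotate _ b)) = D.linkSum (pos b) := by
  have hne : pos b (D.partner b) ≠ 0 := fun h => D.partner_ne b (pos_eq_zero.1 h)
  have hlt := pos_lt b (D.partner b)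
  set c : Fin (2 * D.n) → ℚ := fun l => if 0 < pos b l ∧ pos b l < pos b (D.partner b) ∧
      pos b (D.partner b) < pos b (D.partner l) then D.sgn l else 0 with hc
  have hsum : ∑ l, c l = 0 := hD.sum_sgn b
  have term : ∀ i l, (if D.Linked (pos b) i l then D.sgn i * D.sgn l else 0) =
      (if D.Linked (pos (finRotate _ b)) i l then D.sgn i * D.sgn l else 0) +
      (if i = b then D.sgn b * c l else 0) - (if l = D.partner b then c i * D.sgn l else 0) := by
    intro i l
    have hi := pos_lt b i
    have hl := pos_lt b l
    have hpi := pos_lt b (D.partner i)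
    have hpl := pos_lt b (D.partner l)
    simp only [Linked, pos_finRotate_base, hc]
    by_cases h1 : i = b
    · subst h1
      simp only [pos_self, if_true, if_neg hne, lt_irrefl, false_and, if_false, zero_mul, ite_self,
        sub_zero]
      split_ifs <;> first | omega | simp
    by_cases h2 : l = D.partner b
    · subst h2
      have h6 : pos b i ≠ 0 := fun h => h1 (pos_eq_zero.1 h)
      simp only [if_neg h1, if_true, D.partner_partner, pos_self, if_neg hne, if_neg h6]
      split_ifs <;> first | omega | simp
    · rw [if_neg h1, if_neg h2, add_zero, sub_zero]
      have h6 : pos b i ≠ 0 := fun h => h1 (pos_eq_zero.1 h)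
      have h7 : pos b (D.partner l) ≠ 0 := fun h => h2 (by rw [← pos_eq_zero.1 h, D.partner_partner])
      congr 1
      apply propext
      split_ifs <;> omega
  unfold linkSum
  simp only [term, Finset.sum_add_distrib, Finset.sum_sub_distrib, Finset.sum_ite_eq',
    Finset.mem_univ, if_true]
  rw [Finset.sum_comm (f := fun i l => if i = b then _ else _)]
  simp only [Finset.sum_ite_eq', Finset.mem_univ, if_true, ← Finset.mul_sum, ← Finset.sum_mul,
    hsum, mul_zero, zero_mul, add_zero, sub_zero]

theorem linkSum_congr {π ρ : Fin (2 * D.n) → ℕ} (h : ∀ x y, π x < π y ↔ ρ x < ρ y) :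
    D.linkSum π = D.linkSum ρ := by
  unfold linkSum Linked
  refine Finset.sum_congr rfl fun i _ => Finset.sum_congr rfl fun l _ => if_congr ?_ rfl rfl
  rw [h, h, h]

theorem CyclesBound.linkSum_pos (hD : D.CyclesBound ℚ) (b : Fin (2 * D.n)) :
    D.linkSum (pos b) = D.linkSum (fun x => (x : ℕ)) := by
  have h0 : 0 < 2 * D.n := lt_of_le_of_lt (Nat.zero_le _) b.2
  rw [eq_of_finRotate_invariant (f := fun b => D.linkSum (pos b))
    (fun b => hD.linkSum_finRotate b) b ⟨0, h0⟩]
  exact linkSum_congr fun x y => by simp [pos]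

end Sign

end CurveDiagram

/-! ### Invariance of `linkSum` under the moves `1b` and `s2b`. -/

section Position

variable {N : ℕ}

theorem pos_finRotate_finRotate (b x : Fin N) :
    pos (finRotate N b) (finRotate N x) = pos b x := by
  have h := pos_lt b x
  have h' := pos_finRotate b x
  rw [pos_finRotate_base]
  split_ifs at * <;> omega

theorem pos_finRotate_pow (r : ℕ) (b x : Fin N) :
    pos ((finRotate N ^ r) b) ((finRotate N ^ r) x) = pos b x := by
  induction r with
  | zero => rfl
  | succ r ih => rw [pow_succ', Equiv.Perm.mul_apply, Equiv.Perm.mul_apply,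
      pos_finRotate_finRotate, ih]

/-- An embedding which respects the cyclic order respects the linear orders for suitable base
points. -/
theorem exists_base_of_strictMono {M : ℕ} (hM : 0 < M) {e : Fin M → Fin N} {r : ℕ}
    (he : StrictMono fun i => e ((finRotate M ^ r) i)) (b : Fin N) :
    ∃ c : Fin M, ∀ x y, pos b (e x) < pos b (e y) ↔ pos c x < pos c y := by
  set c₀ : Fin M := (finRotate M ^ r) ⟨0, hM⟩ with hc₀
  have hpos : ∀ i : Fin M, pos c₀ ((finRotate M ^ r) i) = i := fun i => by
    rw [hc₀, pos_finRotate_pow]; simp [pos]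
  have hlt : ∀ x y, e x < e y ↔ pos c₀ x < pos c₀ y := by
    intro x y
    obtain ⟨i, rfl⟩ := (finRotate M ^ r).surjective x
    obtain ⟨j, rfl⟩ := (finRotate M ^ r).surjective y
    rw [hpos, hpos]
    exact he.lt_iff_lt
  by_cases hex : ∃ x, b ≤ e x
  · classical
    obtain ⟨d, hd, hmin⟩ := Finset.exists_min_image (Finset.univ.filter fun x => b ≤ e x)
      (pos c₀) (by obtain ⟨x, hx⟩ := hex; exact ⟨x, by simpa using hx⟩)
    simp only [Finset.mem_filter, Finset.mem_univ, true_and] at hd hmin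
    have hb : ∀ x, b ≤ e x ↔ pos c₀ d ≤ pos c₀ x := by
      intro x
      refine ⟨hmin x, fun h => hd.trans ?_⟩
      rw [← not_lt] at h ⊢
      rwa [hlt]
    refine ⟨d, fun x y => ?_⟩
    rw [pos_change c₀ d x, pos_change c₀ d y]
    have h1 := hb x
    have h2 := hb y
    have h3 := hlt x y
    have h4 := pos_lt c₀ x
    have h5 := pos_lt c₀ y
    have h6 := pos_lt c₀ d
    rw [Fin.le_def] at h1 h2
    rw [Fin.lt_def] at h3
    rw [pos, pos]
    by_cases A : (b : ℕ) ≤ e x <;> by_cases B : (b : ℕ) ≤ e y <;>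
      simp only [A, B, true_iff, false_iff, if_true, if_false] at h1 h2 ⊢ <;>
      simp only [h1, h2, if_true, if_false] <;> omega
  · push Not at hex
    refine ⟨c₀, fun x y => ?_⟩
    have h1 := hex x
    have h2 := hex y
    rw [← hlt, Fin.lt_def]
    rw [Fin.lt_def] at h1 h2
    rw [pos, if_neg (not_le.2 h1), pos, if_neg (not_le.2 h2)]
    omega

end Position

namespace CurveDiagram

variable {D E : CurveDiagram}

/-- A double point at which the curve forms a loop consisting of the edge `i` only. -/
theorem turn_eq_self_iff {i : Fin (2 * D.n)} :
    (∃ s, D.turn (i, s) = (i, s)) ↔ D.partner i = finRotate _ i := by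
  constructor
  · rintro ⟨s, h⟩
    cases s
    · unfold turn at h
      simp only at h
      split_ifs at h with hl
      · rw [Prod.mk.injEq, Equiv.symm_apply_eq] at h
        exact h.1
      · simp at h
    · unfold turn at h
      simp only at h
      split_ifs at h with hl
      · rw [Prod.mk.injEq] at h
        rw [← D.partner_partner (finRotate _ i), h.1]
      · simp at h
  · intro h
    cases hl : D.left i
    · refine ⟨true, ?_⟩
      have := left_partner_of_false hl
      rw [h] at this
      simp only [turn, this, if_true]
      rw [← h, D.partner_partner]
    · refine ⟨false, ?_⟩
      simp only [turn, hl, if_true, h, Equiv.symm_apply_apply]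

/-- The edges `i` and `j` bound a strong `2`-gon. -/
theorem exists_turn_iff {i j : Fin (2 * D.n)} :
    (∃ s, D.turn (i, s) = (j, s) ∧ D.turn (j, s) = (i, s)) ↔
      D.partner i = finRotate _ j ∧ D.partner j = finRotate _ i ∧ D.left i = D.left j := by
  constructor
  · rintro ⟨s, h, h'⟩
    cases s
    · unfold turn at h h'
      simp only at h h'
      split_ifs at h h' with hl hl'
      · rw [Prod.mk.injEq, Equiv.symm_apply_eq] at h h'
        exact ⟨h.1, h'.1, hl.trans hl'.symm⟩
      all_goals simp at h h'
    · unfold turn at h h'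
      simp only at h h'
      split_ifs at h h' with hl hl'
      · rw [Prod.mk.injEq] at h h'
        have e1 := left_partner_of_true hl
        have e2 := left_partner_of_true hl'
        rw [h.1] at e1
        rw [h'.1] at e2
        refine ⟨?_, ?_, e2.trans e1.symm⟩
        · rw [← h'.1, D.partner_partner]
        · rw [← h.1, D.partner_partner]
      all_goals simp at h h'
  · rintro ⟨h1, h2, h3⟩
    cases hl : D.left i
    · refine ⟨true, ?_⟩
      have e1 := left_partner_of_false hl
      have e2 := left_partner_of_false (h3.symm.trans hl)
      rw [h1] at e1
      rw [h2] at e2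
      simp only [turn, e1, e2, if_true]
      rw [← h1, ← h2, D.partner_partner, D.partner_partner]
      exact ⟨rfl, rfl⟩
    · refine ⟨false, ?_⟩
      simp only [turn, hl, h3.symm.trans hl, if_true, h1, h2, Equiv.symm_apply_apply, and_self]

/-- How `linkSum` behaves under the removal of passages. -/
theorem linkSum_removal {e : Fin (2 * E.n) → Fin (2 * D.n)} (he : Function.Injective e)
    {s : Set (Fin (2 * D.n))} (hs : Set.range e = sᶜ)
    (hp : ∀ i, e (E.partner i) = D.partner (e i)) (hl : ∀ i, E.left i = D.left (e i))
    (π : Fin (2 * D.n) → ℕ) (h1 : ∀ i ∉ s, ∀ l ∈ s, ¬ D.Linked π i l)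
    {r : Fin (2 * D.n) → ℚ}
    (hr : ∀ i, r i = ∑ l, if D.Linked π i l then D.sgn i * D.sgn l else 0)
    {t : Finset (Fin (2 * D.n))} (hts : ∀ i, i ∈ t ↔ i ∈ s) (h2 : ∑ i ∈ t, r i = 0) :
    D.linkSum π = E.linkSum fun x => π (e x) := by
  classical
  have hsg : ∀ i, E.sgn i = D.sgn (e i) := fun i => by rw [sgn, sgn, hl]
  have hns : ∀ i, i ∉ Set.range e ↔ i ∈ s := fun i => by rw [hs, Set.mem_compl_iff, not_not]
  have hrow : ∀ x, r (e x) =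
      ∑ y, if E.Linked (fun x => π (e x)) x y then E.sgn x * E.sgn y else 0 := by
    intro x
    rw [hr]
    symm
    refine Fintype.sum_of_injective e he _ _ (fun l hl' => if_neg (h1 _ ?_ _ ((hns l).1 hl')))
      fun y => ?_
    · rw [← hns, not_not]; exact ⟨x, rfl⟩
    · simp only [Linked, hp, hsg]
  have hsplit : ∀ i, r i = (if i ∈ t then r i else 0) + if i ∈ t then 0 else r i := fun i => by
    split_ifs <;> simp
  unfold linkSum
  simp only [← hr, ← hrow]
  rw [Finset.sum_congr rfl fun i _ => hsplit i, Finset.sum_add_distrib, Finset.sum_ite_mem,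
    Finset.univ_inter, h2, zero_add]
  symm
  refine Fintype.sum_of_injective e he _ _ (fun i hi => if_pos ((hts i).2 ((hns i).1 hi)))
    fun x => (if_neg ?_).symm
  rw [hts, ← hns, not_not]
  exact ⟨x, rfl⟩

end CurveDiagram

namespace KnotProjection

open CurveDiagram

variable {P P' : KnotProjection}

theorem linkSum_pos_eq (P : KnotProjection) (b : Fin (2 * P.n)) :
    P.linkSum (pos b) = P.linkSum (fun x => (x : ℕ)) := by
  have := b.2
  exact (P.cyclesBound (by omega) ℚ).linkSum_pos b

theorem linkSum_cyclic {N : ℕ} {e : Fin (2 * P'.n) → Fin N} {r : ℕ}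
    (he : StrictMono fun i => e ((finRotate (2 * P'.n) ^ r) i)) (b : Fin N) :
    (P'.linkSum fun x => pos b (e x)) = P'.linkSum (fun x => (x : ℕ)) := by
  rcases Nat.eq_zero_or_pos (2 * P'.n) with h | h
  · exact linkSum_congr fun x _ => absurd x.2 (by omega)
  · obtain ⟨c, hc⟩ := exists_base_of_strictMono h he b
    rw [← linkSum_pos_eq P' c]
    exact linkSum_congr hc

theorem injective_of_strictMono_comp {M N : ℕ} {e : Fin M → Fin N} {r : ℕ}
    (he : StrictMono fun i => e ((finRotate M ^ r) i)) : Function.Injective e := by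
  intro x y hxy
  obtain ⟨i, rfl⟩ := (finRotate M ^ r).surjective x
  obtain ⟨j, rfl⟩ := (finRotate M ^ r).surjective y
  rw [he.injective hxy]

/-- Seen from the base point `i`, the removed chord joins the positions `0` and `1`; no chord can
cross it. -/
theorem Move1b.linkSum_eq (h : Move1b P P') :
    P.linkSum (fun x => (x : ℕ)) = P'.linkSum (fun x => (x : ℕ)) := by
  obtain ⟨i, s, hi, e, ⟨r, he⟩, hs, hp, hl⟩ := h
  have hi' := turn_eq_self_iff.1 ⟨s, hi⟩
  have hi2 : P.partner (finRotate _ i) = i := by rw [← hi', P.partner_partner]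
  have h0 := pos_self i
  have hlt := pos_lt i i
  have h1 := pos_finRotate i i
  have hne : pos i (finRotate _ i) ≠ 0 := fun h =>
    P.partner_ne i (hi'.trans (pos_eq_zero.1 h))
  rw [if_neg (by intro h; rw [if_pos h] at h1; exact hne h1), h0, zero_add] at h1
  rw [← linkSum_pos_eq P i, ← linkSum_cyclic he i]
  have hno : ∀ x ∈ ({i, finRotate _ i} : Set (Fin (2 * P.n))), ∀ y,
      ¬ P.Linked (pos i) x y ∧ ¬ P.Linked (pos i) y x := by
    rintro x (rfl | rfl) y
    · simp only [Linked, hi', h0, h1]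
      omega
    · simp only [Linked, hi2, h0, h1]
      refine ⟨by omega, ?_⟩
      rintro ⟨a, b, c⟩
      omega
  refine linkSum_removal (injective_of_strictMono_comp he) hs hp hl _
    (fun x _ y hy => (hno y hy x).2) (fun _ => rfl) (t := {i, finRotate _ i}) (by simp) ?_
  refine Finset.sum_eq_zero fun x hx => Finset.sum_eq_zero fun y _ => if_neg ?_
  exact (hno x (by simpa using hx) y).1

/-- The removed chords are `{i, j + 1}` and `{i + 1, j}`. They are nested and cross the same other
chords; the coherent orientation gives their starting passages opposite signs. From the base point
`i` they start before all other chords, so they occur only as the first chord of a pair. -/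
theorem MoveS2b.linkSum_eq (h : MoveS2b P P') :
    P.linkSum (fun x => (x : ℕ)) = P'.linkSum (fun x => (x : ℕ)) := by
  obtain ⟨i, j, s, hij, hi, hj, e, ⟨r, he⟩, hs, hp, hl⟩ := h
  obtain ⟨k1, k2, k3⟩ := exists_turn_iff.1 ⟨s, hi, hj⟩
  have k1' : P.partner (finRotate _ j) = i := by rw [← k1, P.partner_partner]
  have k2' : P.partner (finRotate _ i) = j := by rw [← k2, P.partner_partner]
  have h0 := pos_self i
  have hlt := pos_lt i j
  have hj0 : pos i j ≠ 0 := fun h => hij (pos_eq_zero.1 h).symm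
  have h1 := pos_finRotate i i
  rw [h0, if_neg (by omega), zero_add] at h1
  have hj1 : pos i j ≠ 1 := fun h => P.partner_ne j (by rw [k2]; exact pos_inj.1 (h1.trans h.symm))
  have h2 := pos_finRotate i j
  have hj2 : pos i (finRotate _ j) ≠ 0 := fun h =>
    P.partner_ne i (k1.trans (pos_eq_zero.1 h))
  rw [if_neg (by intro h; rw [if_pos h] at h2; exact hj2 h2)] at h2
  rw [← linkSum_pos_eq P i, ← linkSum_cyclic he i]
  have hinj : ∀ x y : Fin (2 * P.n), pos i x = pos i y ↔ x = y := fun x y => pos_inj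
  have hsg : P.sgn (finRotate _ i) = - P.sgn i := by
    rw [← k2, sgn_partner, sgn, sgn, k3]
  have hdis : i ≠ finRotate _ i ∧ i ≠ j ∧ i ≠ finRotate _ j ∧ finRotate _ i ≠ j ∧
      finRotate _ i ≠ finRotate _ j ∧ j ≠ finRotate _ j := by
    simp only [ne_eq, ← hinj]
    omega
  refine linkSum_removal (injective_of_strictMono_comp he) hs hp hl _ ?_ (fun _ => rfl)
    (t := {i, finRotate _ i, j, finRotate _ j}) (by simp) ?_
  · rintro x hx y hy ⟨a, b, c⟩
    simp only [Set.mem_insert_iff, Set.mem_singleton_iff, not_or, ← hinj] at hx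
    rcases hy with rfl | rfl | rfl | rfl
    · omega
    · rw [k2'] at c
      omega
    · rw [k2] at c
      omega
    · rw [k1'] at c
      omega
  · rw [Finset.sum_insert (by
      simp only [Finset.mem_insert, Finset.mem_singleton, not_or]
      exact ⟨hdis.1, hdis.2.1, hdis.2.2.1⟩),
      Finset.sum_insert (by
        simp only [Finset.mem_insert, Finset.mem_singleton, not_or]
        exact ⟨hdis.2.2.2.1, hdis.2.2.2.2.1⟩),
      Finset.sum_insert (by simpa using hdis.2.2.2.2.2), Finset.sum_singleton]
    -- `j` and its successor are second ends of their chords, so no pair is listed under them.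
    have z1 : ∑ l, (if P.Linked (pos i) j l then P.sgn j * P.sgn l else 0) = 0 := by
      refine Finset.sum_eq_zero fun l _ => if_neg ?_
      simp only [Linked, k2]
      omega
    have z2 : ∑ l, (if P.Linked (pos i) (finRotate _ j) l then
        P.sgn (finRotate _ j) * P.sgn l else 0) = 0 := by
      refine Finset.sum_eq_zero fun l _ => if_neg ?_
      simp only [Linked, k1']
      omega
    rw [z1, z2, add_zero, add_zero, ← Finset.sum_add_distrib]
    refine Finset.sum_eq_zero fun l _ => ?_
    have : P.Linked (pos i) i l ↔ P.Linked (pos i) (finRotate _ i) l := by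
      simp only [Linked, k1, k2', h0, h1, h2]
      constructor
      · rintro ⟨a, b, c⟩
        have n1 : pos i l ≠ 1 := fun h => by
          have : l = finRotate _ i := pos_inj.1 (h.trans h1.symm)
          rw [this, k2'] at c
          omega
        have n2 : pos i l ≠ pos i j := fun h => by
          rw [pos_inj.1 h, k2] at c
          omega
        omega
      · rintro ⟨a, b, c⟩
        have n1 : pos i (P.partner l) ≠ pos i j + 1 := fun h => by
          have : P.partner l = finRotate _ j := pos_inj.1 (h.trans h2.symm)
          rw [← k1] at this
          rw [P.toCurveDiagram.partner_injective this] at a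
          omega
        omega
    simp only [this, hsg]
    split_ifs <;> ring

theorem Obtained.linkSum_eq_zero (h : Obtained P) : P.linkSum (fun x => (x : ℕ)) = 0 := by
  induction h with
  | simple P h => exact Finset.sum_eq_zero fun i _ => absurd i.2 (by omega)
  | inv1b P P' _ hm ih => rw [hm.linkSum_eq, ih]
  | invS2b P P' _ hm ih => rw [hm.linkSum_eq, ih]

end KnotProjection

/-! ### The Conway polynomial up to degree two. -/

theorem Equiv.Perm.SameCycle.apply_eq_of_invariant {β α : Type*} [Finite β] {σ : Equiv.Perm β}
    {f : β → α} (hf : ∀ x, f (σ x) = f x) {x y : β} (h : σ.SameCycle x y) : f x = f y := by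
  obtain ⟨i, -, rfl⟩ := h.exists_pow_eq'
  induction i with
  | zero => rfl
  | succ i ih =>
    rw [pow_succ', Equiv.Perm.mul_apply, hf]
    exact ih ⟨(i : ℤ), by rw [zpow_natCast]⟩

theorem val_finRotate_pow {N : ℕ} (h : 0 < N) {k : ℕ} (hk : k < N) :
    ((finRotate N ^ k) ⟨0, h⟩ : ℕ) = k := by
  induction k with
  | zero => rfl
  | succ k ih =>
    rw [pow_succ', Equiv.Perm.mul_apply, val_finRotate, ih (by omega), if_neg (by omega)]

namespace LinkDiagram

variable {m : ℕ} (D : LinkDiagram m)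

variable {D} in
theorem mem_bad {i : Fin m} :
    i ∈ D.bad ↔ D.partner i ≠ i ∧ D.Before i (D.partner i) ∧ D.upper i = false := by
  simp only [bad, Finset.mem_filter, Finset.mem_univ, true_and]

theorem bad_switch_eq {i : Fin m} (hi : i ∈ D.bad) : (D.switch i).bad = D.bad.erase i := by
  classical
  have hi' := mem_bad.1 hi
  refine (Finset.eq_of_subset_of_card_le ?_ ?_).symm
  · intro k hk
    rw [Finset.mem_erase] at hk
    obtain ⟨hki, hk⟩ := hk
    have hk' := mem_bad.1 hk
    have hkp : k ≠ D.partner i := by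
      rintro rfl
      have := D.upper_partner i hi'.1
      rw [hi'.2.2, hk'.2.2] at this
      simp at this
    refine mem_bad.2 ⟨hk'.1, hk'.2.1, ?_⟩
    simp [switch, hki, hkp, hk'.2.2]
  · have := D.bad_switch hi
    rw [Finset.card_erase_of_mem hi]
    omega

theorem sign_switch {i k : Fin m} (h1 : k ≠ i) (h2 : k ≠ D.partner i) :
    (D.switch i).sign k = D.sign k := by
  simp [sign, switch, h1, h2]

theorem sign_partner {i : Fin m} (h : D.partner i ≠ i) : D.sign (D.partner i) = D.sign i := by
  simp only [sign, D.left_partner i h, D.upper_partner i h, Bool.not_inj_iff]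

theorem conway_of_bad (h : D.bad.Nonempty) :
    D.conway = (D.switch (D.bad.min' h)).conway +
      C (D.sign (D.bad.min' h)) * X * (D.smooth (D.bad.min' h)).conway := by
  rw [conway, dif_pos h]

theorem conway_of_descending (h : ¬ D.bad.Nonempty) :
    D.conway = if D.components = 1 then 1 else 0 := by
  rw [conway, dif_neg h]

theorem conway_coeff_zero : D.conway.coeff 0 = if D.components = 1 then 1 else 0 := by
  induction hk : D.bad.card using Nat.strong_induction_on generalizing D with
  | _ k ih =>
  by_cases h : D.bad.Nonempty
  · rw [conway_of_bad D h, coeff_add, mul_assoc, coeff_C_mul, coeff_X_mul_zero, mul_zero, add_zero,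
      ih _ (hk ▸ D.bad_switch (D.bad.min'_mem h)) _ rfl]
    rfl
  · rw [conway_of_descending D h]
    split_ifs <;> simp

/-- Each skein step contributes the sign times the constant coefficient of the smoothing. Switching
one bad crossing changes neither the signs at the other bad passages nor the number of components of
their smoothings, so the contributions simply add up. -/
theorem conway_coeff_one : D.conway.coeff 1 =
    ∑ i ∈ D.bad, if (D.smooth i).components = 1 then D.sign i else 0 := by
  induction hk : D.bad.card using Nat.strong_induction_on generalizing D with
  | _ k ih =>
  by_cases h : D.bad.Nonempty
  · have hm := D.bad.min'_mem h
    rw [conway_of_bad D h, coeff_add, mul_assoc, coeff_C_mul, coeff_X_mul, conway_coeff_zero,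
      ih _ (hk ▸ D.bad_switch hm) _ rfl, bad_switch_eq D hm, ← Finset.sum_erase_add _ _ hm]
    congr 1
    · refine Finset.sum_congr rfl fun k hk => ?_
      rw [Finset.mem_erase] at hk
      have hk' := mem_bad.1 hk.2
      have hm' := mem_bad.1 hm
      rw [sign_switch D hk.1 ?_]
      · rfl
      · intro he
        have := D.upper_partner _ hm'.1
        rw [← he, hk'.2.2, hm'.2.2] at this
        simp at this
    · split_ifs <;> simp
  · rw [conway_of_descending D h, Finset.not_nonempty_iff_eq_empty.1 h, Finset.sum_empty]
    split_ifs <;> simp [coeff_one]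

theorem base_sameCycle (i : Fin m) : D.next.SameCycle i (D.base i) := by
  classical
  have := Finset.min'_mem (Finset.univ.filter fun k => D.next.SameCycle i k)
    ⟨i, by simp [Equiv.Perm.SameCycle.refl]⟩
  simp only [Finset.mem_filter, Finset.mem_univ, true_and] at this
  unfold base
  convert this

theorem base_le {i k : Fin m} (h : D.next.SameCycle i k) : D.base i ≤ k := by
  unfold base
  exact Finset.min'_le _ _ (by simpa using h)

theorem before_iff (hD : D.next = finRotate m) (i j : Fin m) : D.Before i j ↔ i < j := by
  have h0 : 0 < m := lt_of_le_of_lt (Nat.zero_le _) i.2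
  have hs : ∀ x y, D.next.SameCycle x y := fun x y => by
    have := eq_of_finRotate_invariant (f := fun y => D.next.SameCycle x y)
      (fun y => propext (by rw [← hD]; exact Equiv.Perm.sameCycle_apply_right)) y x
    rw [this]
  have hb : ∀ x, D.base x = ⟨0, h0⟩ := fun x => by
    have h1 := D.base_le (hs x ⟨0, h0⟩)
    rw [Fin.le_def] at h1
    exact Fin.ext (Nat.le_zero.1 h1)
  have hst : ∀ x, D.steps x = x := fun x => by
    refine IsLeast.csInf_eq ⟨?_, fun k hk => ?_⟩
    · simp only [Set.mem_ofPred_eq, hb, hD]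
      exact Fin.ext (val_finRotate_pow h0 x.2)
    · simp only [Set.mem_ofPred_eq, hb, hD] at hk
      by_contra hlt
      have := val_finRotate_pow h0 (k := k) (by have := x.2; omega)
      rw [hk] at this
      omega
  rw [Before, hb, hb, hst, hst]
  simp

theorem components_eq_one_iff (i : Fin m) :
    D.components = 1 ↔ D.free = 0 ∧
      ∀ x, (Quot.mk (fun a b => D.next a = b) x) = Quot.mk _ i := by
  have : Nonempty (Quot fun a b => D.next a = b) := ⟨Quot.mk _ i⟩
  have hpos : 0 < Nat.card (Quot fun a b => D.next a = b) := Nat.card_pos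
  have h1 : Nat.card (Quot fun a b => D.next a = b) = 1 ↔
      ∀ x, (Quot.mk (fun a b => D.next a = b) x) = Quot.mk _ i := by
    rw [Nat.card_eq_one_iff_unique]
    constructor
    · rintro ⟨h, -⟩ x
      exact h.elim _ _
    · intro h
      refine ⟨⟨fun a b => ?_⟩, this⟩
      induction a using Quot.inductionOn with | _ x =>
      induction b using Quot.inductionOn with | _ y =>
      exact (h x).trans (h y).symm
  rw [← h1]
  unfold components
  omega

theorem components_ne_one {f : Fin m → Prop} (hf : ∀ x, f (D.next x) = f x) {x y : Fin m}
    (hxy : f x ≠ f y) : D.components ≠ 1 := by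
  intro h
  refine hxy ?_
  have h' := ((D.components_eq_one_iff y).1 h).2 x
  exact congrArg (Quot.lift f fun a b hab => by rw [← hab, hf]) h'

section Knot

variable {D} (hD : D.next = finRotate m) {i : Fin m} (hi : i < D.partner i)
include hD

theorem smooth_next_apply (x : Fin m) :
    (D.smooth i).next x = finRotate m (Equiv.swap i (D.partner i) x) := by
  simp only [smooth, hD, Equiv.trans_apply]

include hi

/-- Smoothing splits the knot into an inner component `(i, partner i]` and an outer one. The
smoothed `next` sends `i` to the successor of `partner i`, hence the half-open interval. -/
theorem smooth_invariant (x : Fin m) :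
    (i < (D.smooth i).next x ∧ (D.smooth i).next x ≤ D.partner i) = (i < x ∧ x ≤ D.partner i) := by
  rw [smooth_next_apply hD]
  have h1 := val_finRotate x
  have h2 := val_finRotate i
  have h3 := val_finRotate (D.partner i)
  simp only [Fin.lt_def, Fin.le_def] at *
  rcases eq_or_ne x i with rfl | hxi
  · rw [Equiv.swap_apply_left]
    apply propext
    split_ifs at h3 <;> omega
  rcases eq_or_ne x (D.partner i) with rfl | hxj
  · rw [Equiv.swap_apply_right]
    apply propext
    split_ifs at h2 <;> omega
  rw [Equiv.swap_apply_of_ne_of_ne hxi hxj]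
  have h4 : (x : ℕ) ≠ i := fun h => hxi (Fin.ext h)
  have h5 : (x : ℕ) ≠ D.partner i := fun h => hxj (Fin.ext h)
  apply propext
  split_ifs at h1 <;> omega

/-- Smoothing a point whose two passages lie on the same side keeps the splitting into inner and
outer points. -/
theorem components_smooth_smooth_ne_one {k : Fin m}
    (h : (i < k ∧ k ≤ D.partner i) =
      (i < (D.smooth i).partner k ∧ (D.smooth i).partner k ≤ D.partner i)) :
    ((D.smooth i).smooth k).components ≠ 1 := by
  refine components_ne_one _ (f := fun x => i < x ∧ x ≤ D.partner i) (x := i) (y := D.partner i)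
    (fun x => ?_) ?_
  · have : ((D.smooth i).smooth k).next x =
        (D.smooth i).next (Equiv.swap k ((D.smooth i).partner k) x) := rfl
    rw [this, smooth_invariant hD hi]
    rcases eq_or_ne x k with rfl | hxk
    · rw [Equiv.swap_apply_left]
      exact h.symm
    rcases eq_or_ne x ((D.smooth i).partner k) with rfl | hxl
    · rw [Equiv.swap_apply_right]
      exact h
    rw [Equiv.swap_apply_of_ne_of_ne hxk hxl]
  · intro h
    have : i < D.partner i ∧ D.partner i ≤ D.partner i := ⟨hi, le_refl _⟩
    rw [← h] at this
    exact lt_irrefl _ this.1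

/-- Two crossing chords cut the circle into four arcs, ending at `l`, `partner i`, `partner l` and
`i`. Each arc stays in one component, and the two smoothings link the four arcs cyclically into a
single one. -/
theorem components_smooth_smooth_eq_one (hfree : D.free = 0) {l : Fin m} (h1 : i < l)
    (h2 : l < D.partner i) (h3 : D.partner i < D.partner l) :
    ((D.smooth i).smooth (D.partner l)).components = 1 := by
  set j := D.partner i with hj
  set k := D.partner l with hk
  have hpk : (D.smooth i).partner k = l := by
    simp only [smooth, ← hj]
    rw [if_neg, hk, D.partner_partner]
    rintro (h | h)
    · exact absurd (hi.trans h3) (by rw [h]; exact lt_irrefl _)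
    · exact absurd h3 (by rw [h]; exact lt_irrefl _)
  rw [components_eq_one_iff _ j]
  refine ⟨hfree, ?_⟩
  set S := (D.smooth i).smooth k with hS
  have hnext : ∀ x, S.next x = finRotate m (Equiv.swap i j (Equiv.swap k l x)) := by
    intro x
    have : S.next x = (D.smooth i).next (Equiv.swap k ((D.smooth i).partner k) x) := rfl
    rw [this, hpk, smooth_next_apply hD]
  set f : Fin m → Quot (fun a b => S.next a = b) := fun x => Quot.mk _ x with hf
  have hinv : ∀ x, f (finRotate m (Equiv.swap i j (Equiv.swap k l x))) = f x := fun x => by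
    rw [← hnext]
    exact (Quot.sound (r := fun a b => S.next a = b) rfl).symm
  have hik : i < k := hi.trans h3
  have hlk : l < k := h2.trans h3
  have fi : f (finRotate m j) = f i := by
    have := hinv i
    rwa [Equiv.swap_apply_of_ne_of_ne hik.ne h1.ne, Equiv.swap_apply_left] at this
  have fj : f (finRotate m i) = f j := by
    have := hinv j
    rwa [Equiv.swap_apply_of_ne_of_ne h3.ne h2.ne', Equiv.swap_apply_right] at this
  have fk : f (finRotate m l) = f k := by
    have := hinv k
    rwa [Equiv.swap_apply_left, Equiv.swap_apply_of_ne_of_ne h1.ne' h2.ne] at this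
  have fl : f (finRotate m k) = f l := by
    have := hinv l
    rwa [Equiv.swap_apply_right, Equiv.swap_apply_of_ne_of_ne hik.ne' h3.ne'] at this
  have fx : ∀ x, x ≠ i → x ≠ j → x ≠ k → x ≠ l → f (finRotate m x) = f x := by
    intro x a b c d
    have := hinv x
    rwa [Equiv.swap_apply_of_ne_of_ne c d, Equiv.swap_apply_of_ne_of_ne a b] at this
  set c := finRotate m i with hc
  have hpos : ∀ x, pos c x = if pos i x = 0 then m - 1 else pos i x - 1 := pos_finRotate_base i
  have hlt := k.2
  rw [Fin.lt_def] at h1 h2 h3 hik hlk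
  have pi : pos c i = m - 1 := by rw [hpos, pos_self, if_pos rfl]
  have pl : pos c l = l - i - 1 := by
    have : pos i l = l - i := if_pos (by omega)
    rw [hpos, this, if_neg (by omega)]
  have pj : pos c j = j - i - 1 := by
    have : pos i j = j - i := if_pos (by omega)
    rw [hpos, this, if_neg (by omega)]
  have pk : pos c k = k - i - 1 := by
    have : pos i k = k - i := if_pos (by omega)
    rw [hpos, this, if_neg (by omega)]
  have arc : ∀ s t, (∀ x, s ≤ pos c x → pos c x + 1 ≤ t → pos c x ≠ pos c i ∧ pos c x ≠ pos c j ∧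
      pos c x ≠ pos c k ∧ pos c x ≠ pos c l) → ∀ x y, s ≤ pos c x → pos c x ≤ t →
      s ≤ pos c y → pos c y ≤ t → f x = f y := by
    intro s t h x y a b a' b'
    refine eq_of_arc_invariant (b := c) (s := s) (t := t) (fun w u v _ => ?_) a b a' b'
    obtain ⟨n1, n2, n3, n4⟩ := h w u v
    exact fx w (fun h => n1 (by rw [h])) (fun h => n2 (by rw [h])) (fun h => n3 (by rw [h]))
      (fun h => n4 (by rw [h]))
  have pc : pos c c = 0 := pos_self c
  have pl' : pos c (finRotate m l) = pos c l + 1 := by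
    rw [pos_finRotate, if_neg (by omega)]
  have pj' : pos c (finRotate m j) = pos c j + 1 := by
    rw [pos_finRotate, if_neg (by omega)]
  have a1 := arc 0 (pos c l) (fun x _ _ => by omega)
  have a2 := arc (pos c l + 1) (pos c j) (fun x _ _ => by omega)
  have a3 := arc (pos c j + 1) (pos c k) (fun x _ _ => by omega)
  have a4 := arc (pos c k + 1) (pos c i) (fun x _ _ => by omega)
  have e1 : f l = f j := by
    rw [← fj]; exact a1 _ _ (by omega) (by omega) (by omega) (by omega)
  have e2 : f k = f j := by
    rw [← fk]; exact a2 _ _ (by omega) (by omega) (by omega) (by omega)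
  have e3 : f i = f k := by
    rw [← fi]; exact a3 _ _ (by omega) (by omega) (by omega) (by omega)
  intro x
  show f x = f j
  have hx := pos_lt c x
  rcases le_or_gt (pos c x) (pos c l) with g1 | g1
  · rw [a1 x l (by omega) (by omega) (by omega) (by omega), e1]
  rcases le_or_gt (pos c x) (pos c j) with g2 | g2
  · exact a2 x j (by omega) (by omega) (by omega) (by omega)
  rcases le_or_gt (pos c x) (pos c k) with g3 | g3
  · rw [a3 x k (by omega) (by omega) (by omega) (by omega), e2]
  · rw [a4 x i (by omega) (by omega) (by omega) (by omega), e3, e2]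

/-- The outer component contains the passage `0`, so it is traversed before the inner one. -/
theorem smooth_base_outer {x : Fin m} (hx : ¬ (i < x ∧ x ≤ D.partner i)) :
    ((D.smooth i).base x : ℕ) = 0 := by
  have h0 : 0 < m := lt_of_le_of_lt (Nat.zero_le _) i.2
  have hlt := (D.partner i).2
  suffices h : (D.smooth i).next.SameCycle x ⟨0, h0⟩ by
    have := base_le _ h
    rw [Fin.le_def] at this
    exact Nat.le_zero.1 this
  set f : Fin m → Prop := fun y => (D.smooth i).next.SameCycle x y with hf
  have hinv : ∀ y, y ≠ i → y ≠ D.partner i → f (finRotate m y) = f y := by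
    intro y a b
    have h := smooth_next_apply hD (i := i) y
    rw [Equiv.swap_apply_of_ne_of_ne a b] at h
    rw [← h]
    exact propext Equiv.Perm.sameCycle_apply_right
  set c := finRotate m i with hc
  have hpos : ∀ x, pos c x = if pos i x = 0 then m - 1 else pos i x - 1 := pos_finRotate_base i
  have pi : pos c i = m - 1 := by rw [hpos, pos_self, if_pos rfl]
  rw [Fin.lt_def] at hi
  have pj : pos c (D.partner i) = D.partner i - i - 1 := by
    have : pos i (D.partner i) = D.partner i - i := if_pos (by omega)
    rw [hpos, this, if_neg (by omega)]
  have outer : ∀ y : Fin m, ¬ (i < y ∧ y ≤ D.partner i) → pos c (D.partner i) + 1 ≤ pos c y := by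
    intro y hy
    rw [Fin.lt_def, Fin.le_def] at hy
    rw [pj, hpos, pos]
    split_ifs <;> omega
  have key : f x = f ⟨0, h0⟩ := by
    refine eq_of_arc_invariant (b := c) (s := pos c (D.partner i) + 1) (t := m - 1)
      (fun w u v _ => hinv w ?_ ?_) (outer x hx) ?_ (outer _ ?_) ?_
    · rintro rfl; omega
    · intro h; rw [h] at u; omega
    · have := pos_lt c x; omega
    · rw [Fin.lt_def]; simp
    · have := pos_lt c ⟨0, h0⟩; omega
  have hxx : f x := Equiv.Perm.SameCycle.refl _ _
  rwa [key] at hxx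

theorem smooth_base_inner {x : Fin m} (hx : i < x ∧ x ≤ D.partner i) :
    0 < ((D.smooth i).base x : ℕ) := by
  have h := (base_sameCycle (D.smooth i) x).apply_eq_of_invariant
    (f := fun x => i < x ∧ x ≤ D.partner i) (smooth_invariant hD hi)
  have h' : i < (D.smooth i).base x ∧ (D.smooth i).base x ≤ D.partner i := h ▸ hx
  exact lt_of_le_of_lt (Nat.zero_le _) h'.1

/-- Only a crossing between the two components becomes connected when smoothed, and it is first met
on the outer one. If its outer passage were lower and came before `i`, it would be a bad passage of
`D` before the first one; so it comes after `partner i`. -/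
theorem smooth_bad_iff (hfree : D.free = 0) (hp : ∀ k, D.partner k ≠ k)
    (hmin : ∀ k ∈ D.bad, i ≤ k) (l : Fin m) :
    (D.partner l ∈ (D.smooth i).bad ∧ ((D.smooth i).smooth (D.partner l)).components = 1) ↔
      (i < l ∧ l < D.partner i ∧ D.partner i < D.partner l) ∧ D.upper l = true := by
  have hpart : D.partner l ≠ i → D.partner l ≠ D.partner i →
      (D.smooth i).partner (D.partner l) = l := fun a b => by
    simp only [smooth]
    rw [if_neg (by tauto), D.partner_partner]
  have hne : ∀ {x y : Fin m}, D.partner x = D.partner y → x = y := fun {x y} h => by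
    rw [← D.partner_partner x, h, D.partner_partner]
  constructor
  · rintro ⟨hb, hc⟩
    obtain ⟨b1, b2, b3⟩ := mem_bad.1 hb
    have hk : ¬ (D.partner l = i ∨ D.partner l = D.partner i) := by
      intro h
      apply b1
      simp only [smooth]
      rw [if_pos h]
    push Not at hk
    have hl := hpart hk.1 hk.2
    rw [hl] at b1 b2
    have hmix := mt (components_smooth_smooth_ne_one hD hi (k := D.partner l)) (not_not.2 hc)
    rw [hl] at hmix
    have hu : D.upper (D.partner l) = false := b3
    have hu' : D.upper l = true := by
      have := D.upper_partner l (hp l)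
      rw [hu] at this
      simpa using this.symm
    have hli : l ≠ i := fun h => hk.2 (by rw [h])
    have hlj : l ≠ D.partner i := fun h => hk.1 (by rw [h, D.partner_partner])
    by_cases hkB : i < D.partner l ∧ D.partner l ≤ D.partner i
    · exfalso
      have hlA : ¬ (i < l ∧ l ≤ D.partner i) := fun h => hmix (by simp only [h, hkB])
      have e1 := smooth_base_outer hD hi hlA
      have e2 := smooth_base_inner hD hi hkB
      rcases b2 with h | ⟨h, -⟩
      · rw [Fin.lt_def] at h; omega
      · rw [h] at e2; omega
    · have hlB : i < l ∧ l ≤ D.partner i := by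
        by_contra h
        exact hmix (by simp only [h, hkB])
      have hkj : D.partner i < D.partner l := by
        by_contra h
        have hki : D.partner l < i := by
          rw [not_lt] at h
          rcases lt_or_ge i (D.partner l) with h' | h'
          · exact absurd ⟨h', h⟩ hkB
          · exact lt_of_le_of_ne h' hk.1
        refine absurd (hmin (D.partner l) (mem_bad.2 ⟨hp _, ?_, hu⟩))
          (not_le.2 hki)
        rw [before_iff _ hD, D.partner_partner]
        exact hki.trans hlB.1
      exact ⟨⟨hlB.1, lt_of_le_of_ne hlB.2 hlj, hkj⟩, hu'⟩
  · rintro ⟨⟨h1, h2, h3⟩, hu⟩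
    refine ⟨?_, components_smooth_smooth_eq_one hD hi hfree h1 h2 h3⟩
    have hl := hpart (hi.trans h3).ne' h3.ne'
    refine mem_bad.2 ⟨?_, Or.inl ?_, ?_⟩
    · rw [hl]; exact (h2.trans h3).ne
    · rw [hl, Fin.lt_def, smooth_base_outer hD hi (x := D.partner l)
        (fun h => absurd h.2 (not_le.2 h3))]
      exact smooth_base_inner hD hi ⟨h1, h2.le⟩
    · show D.upper (D.partner l) = false
      rw [D.upper_partner l (hp l), hu]
      rfl

theorem smooth_conway_coeff_one (hfree : D.free = 0) (hp : ∀ k, D.partner k ≠ k)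
    (hmin : ∀ k ∈ D.bad, i ≤ k) :
    (D.smooth i).conway.coeff 1 =
      ∑ l, if (i < l ∧ l < D.partner i ∧ D.partner i < D.partner l) ∧ D.upper l = true
        then D.sign l else 0 := by
  classical
  have hinv : Function.Involutive D.partner := D.partner_partner
  rw [conway_coeff_one, ← Finset.univ_inter (D.smooth i).bad, ← Finset.sum_ite_mem,
    ← Equiv.sum_comp hinv.toPerm]
  refine Finset.sum_congr rfl fun l _ => ?_
  rw [Function.Involutive.coe_toPerm, ← ite_and]
  refine if_congr (smooth_bad_iff hD hi hfree hp hmin l) ?_ rfl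
  exact D.sign_partner (hp l)

end Knot

/-- The Polyak–Viro formula for `a₂`. -/
theorem conway_coeff_two (hD : D.next = finRotate m) (hfree : 0 < m → D.free = 0)
    (hp : ∀ k, D.partner k ≠ k) :
    D.conway.coeff 2 = ∑ i, ∑ l,
      if i < l ∧ l < D.partner i ∧ D.partner i < D.partner l then
        if D.upper i = false ∧ D.upper l = true then D.sign i * D.sign l else 0 else 0 := by
  induction hk : D.bad.card using Nat.strong_induction_on generalizing D with
  | _ k ih =>
  have hbad : ∀ {a}, a ∈ D.bad ↔ a < D.partner a ∧ D.upper a = false := fun {a} => by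
    simp only [mem_bad, before_iff D hD, hp, ne_eq, not_false_eq_true, true_and]
  by_cases h : D.bad.Nonempty
  · have hm := D.bad.min'_mem h
    have hmin : ∀ k ∈ D.bad, D.bad.min' h ≤ k := fun k hk => D.bad.min'_le k hk
    rw [conway_of_bad D h]
    set i := D.bad.min' h
    obtain ⟨hi, hu⟩ := hbad.1 hm
    have h0 : 0 < m := lt_of_le_of_lt (Nat.zero_le _) i.2
    rw [coeff_add, mul_assoc, coeff_C_mul, coeff_X_mul,
      smooth_conway_coeff_one hD hi (hfree h0) hp hmin,
      ih _ (hk ▸ D.bad_switch hm) (D.switch i) hD hfree hp rfl]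
    have hsum : D.sign i * (∑ l, if (i < l ∧ l < D.partner i ∧ D.partner i < D.partner l) ∧
        D.upper l = true then D.sign l else 0) =
        ∑ a, ∑ l, if a = i then (if (i < l ∧ l < D.partner i ∧ D.partner i < D.partner l) ∧
          D.upper l = true then D.sign i * D.sign l else 0) else 0 := by
      rw [Finset.sum_comm]
      simp only [Finset.sum_ite_eq', Finset.mem_univ, if_true, Finset.mul_sum, mul_ite, mul_zero]
    rw [hsum, ← Finset.sum_add_distrib]
    refine Finset.sum_congr rfl fun a _ => ?_
    rw [← Finset.sum_add_distrib]
    refine Finset.sum_congr rfl fun l _ => ?_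
    have hpp : (D.switch i).partner = D.partner := rfl
    rw [hpp]
    by_cases hl : a < l ∧ l < D.partner a ∧ D.partner a < D.partner l
    · obtain ⟨l1, l2, l3⟩ := hl
      have hlj : l ≠ D.partner i := by
        rintro rfl
        rw [D.partner_partner] at l3
        exact lt_asymm (l2.trans l3) hi
      have haj : a ≠ D.partner i := by
        rintro rfl
        rw [D.partner_partner] at l2
        exact lt_asymm (l1.trans l2) hi
      simp only [if_pos (show a < l ∧ l < D.partner a ∧ D.partner a < D.partner l from ⟨l1, l2, l3⟩)]
      by_cases hai : a = i
      · rw [hai] at l1 l2 l3 ⊢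
        have : (D.switch i).upper i = true := by simp [switch, hu]
        rw [this, if_neg (by simp), if_pos rfl, zero_add]
        simp only [hu, l1, l2, l3, true_and, and_self]
      · rw [if_neg hai, add_zero]
        -- After the switch the second entry `i` is upper, so the pair could start to count. It does
        -- not: `a` precedes the first bad passage and is the first passage of its crossing, hence
        -- upper.
        by_cases hli : l = i
        · have hua : D.upper a = true := by
            by_contra hn
            have := hmin a (hbad.2 ⟨l1.trans l2, by simpa using hn⟩)
            rw [hli] at l1
            exact absurd l1 (not_lt.2 this)
          have hua' : (D.switch i).upper a = true := by simp [switch, hai, haj, hua]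
          rw [hua, hua', if_neg (by simp), if_neg (by simp)]
        · rw [sign_switch D hai haj, sign_switch D hli hlj]
          have u1 : (D.switch i).upper a = D.upper a := by simp [switch, hai, haj]
          have u2 : (D.switch i).upper l = D.upper l := by simp [switch, hli, hlj]
          rw [u1, u2]
    · rw [if_neg hl, if_neg hl, zero_add]
      split_ifs with h1 h2
      · subst h1
        exact absurd h2.1 hl
      · rfl
      · rfl
  · rw [conway_of_descending D h]
    have : ((if D.components = 1 then 1 else 0 : ℤ[X])).coeff 2 = 0 := by
      split_ifs <;> simp [coeff_one]
    rw [this]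
    symm
    refine Finset.sum_eq_zero fun a _ => Finset.sum_eq_zero fun l _ => ?_
    split_ifs with h1 h2
    · exact absurd ⟨a, hbad.2 ⟨h1.1.trans h1.2.1, h2.1⟩⟩ h
    · rfl
    · rfl

end LinkDiagram

/-! ### Averaging over the resolutions. -/

namespace KnotProjection

open CurveDiagram

variable (P : KnotProjection)

/-- Exchange the branches at one double point. -/
def flip (i : Fin (2 * P.n)) (o : P.Resolution) : P.Resolution :=
  ⟨fun k => if k = i ∨ k = P.partner i then !o.1 k else o.1 k, fun k => by
    have h : (P.partner k = i ∨ P.partner k = P.partner i) ↔ (k = i ∨ k = P.partner i) := by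
      have h := P.partner_partner
      grind
    simp only [h, o.2 k]
    split_ifs <;> rfl⟩

theorem flip_involutive (i : Fin (2 * P.n)) : Function.Involutive (P.flip i) := by
  intro o
  apply Subtype.ext
  funext k
  simp only [flip]
  split_ifs <;> simp

/-- Flipping either of the two distinct double points permutes the resolutions, so all four
over/under patterns at them are equally frequent. -/
theorem sum_resolution {a l : Fin (2 * P.n)} (h1 : l ≠ a) (h2 : l ≠ P.partner a) :
    4 * (∑ o : P.Resolution, if o.1 a = false ∧ o.1 l = true then (1 : ℚ) else 0) =
      Fintype.card P.Resolution := by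
  have hal : a ≠ P.partner l := fun h => h2 (by rw [h, P.partner_partner])
  set c : Bool → Bool → ℚ := fun s t =>
    ∑ o : P.Resolution, if o.1 a = s ∧ o.1 l = t then (1 : ℚ) else 0 with hc
  have ha : ∀ s t, c (!s) t = c s t := fun s t => by
    simp only [hc]
    rw [← Equiv.sum_comp (P.flip_involutive a).toPerm]
    refine Finset.sum_congr rfl fun o _ => ?_
    simp only [Function.Involutive.coe_toPerm, flip, true_or, if_true, h1, h2, or_self, if_false,
      Bool.not_inj_iff]
  have hl : ∀ s t, c s (!t) = c s t := fun s t => by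
    simp only [hc]
    rw [← Equiv.sum_comp (P.flip_involutive l).toPerm]
    refine Finset.sum_congr rfl fun o _ => ?_
    simp only [Function.Involutive.coe_toPerm, flip, true_or, if_true, h1.symm, hal, or_self,
      if_false, Bool.not_inj_iff]
  have hsum : c false false + c false true + (c true false + c true true) =
      Fintype.card P.Resolution := by
    simp only [hc, ← Finset.sum_add_distrib]
    rw [Finset.sum_congr rfl (g := fun _ => (1 : ℚ))]
    · simp
    · intro o _
      cases o.1 a <;> cases o.1 l <;> simp
  have e1 := ha false true
  have e2 := ha false false
  have e3 := hl false false
  simp only [Bool.not_false] at e1 e2 e3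
  rw [← hsum]
  show 4 * c false true = _
  linarith

theorem a₂_diagram (o : P.Resolution) : ((P.diagram o).a₂ : ℚ) =
    ∑ i, ∑ l, if P.Linked (fun x => (x : ℕ)) i l then
      - (P.sgn i * P.sgn l) * (if o.1 i = false ∧ o.1 l = true then 1 else 0) else 0 := by
  rw [LinkDiagram.a₂, LinkDiagram.conway_coeff_two _ rfl ?_ P.partner_ne]
  · push_cast
    refine Finset.sum_congr rfl fun i _ => Finset.sum_congr rfl fun l _ => ?_
    refine if_congr Iff.rfl ?_ rfl
    have hu : (P.diagram o).upper = o.1 := rfl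
    rw [hu]
    split_ifs with h
    · simp only [LinkDiagram.sign, hu, h.1, h.2, sgn]
      have hl : (P.diagram o).left = P.left := rfl
      rw [hl]
      cases P.left i <;> cases P.left l <;> simp
    · simp
  · intro h
    exact if_neg (by omega)

/-- The minus sign appears because `i` is lower and `l` upper in a counted pair: one crossing sign
is `-sgn i`, the other is `sgn l`. The number of resolutions is left as a factor, as only vanishing
is needed. -/
theorem arnold_eq : P.arnold =
    -2 * Fintype.card P.Resolution / 2 ^ P.n * P.linkSum (fun x => (x : ℕ)) := by
  have key : 4 * ∑ o : P.Resolution, ((P.diagram o).a₂ : ℚ) =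
      - Fintype.card P.Resolution * P.linkSum (fun x => (x : ℕ)) := by
    simp only [a₂_diagram, linkSum]
    rw [Finset.sum_comm, Finset.mul_sum, Finset.mul_sum]
    refine Finset.sum_congr rfl fun i _ => ?_
    rw [Finset.sum_comm, Finset.mul_sum, Finset.mul_sum]
    refine Finset.sum_congr rfl fun l _ => ?_
    by_cases h : P.Linked (fun x => (x : ℕ)) i l
    · have h1 : l ≠ i := fun h' => by
        have := h.1
        rw [h'] at this
        exact lt_irrefl _ this
      have h2 : l ≠ P.partner i := fun h' => by
        have := h.2.1
        rw [h'] at this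
        exact lt_irrefl _ this
      simp only [if_pos h, ← Finset.mul_sum]
      rw [← P.sum_resolution h1 h2]
      ring
    · simp only [if_neg h, Finset.sum_const_zero, mul_zero]
  rw [arnold, averageA₂]
  linear_combination (2 / 2 ^ P.n) * key

theorem Obtained.arnold_eq_zero {P : KnotProjection} (h : Obtained P) : P.arnold = 0 := by
  rw [arnold_eq, h.linkSum_eq_zero, mul_zero]

end KnotProjection

/-! ### Removing double points keeps the sphere and creates no triple chord. -/

section Position

variable {N : ℕ}

theorem pos_left_inj {b c x : Fin N} (h : pos b x = pos c x) : b = c := by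
  unfold pos at h
  ext
  split_ifs at h <;> omega

theorem pos_predecessor_le {M : ℕ} {e : Fin M → Fin N} (he : StrictMono e) {x : Fin N} {y : Fin M}
    (hy : finRotate N x = e y) (w : Fin M) :
    pos (e ((finRotate M).symm y)) x ≤ pos (e w) x := by
  set v := (finRotate M).symm y with hv
  have hvy : finRotate M v = y := by rw [hv, Equiv.apply_symm_apply]
  have h1 := val_finRotate v
  have h2 := val_finRotate x
  rw [hvy] at h1
  rw [hy] at h2
  have hm : ∀ a b : Fin M, (a : ℕ) < b → (e a : ℕ) < e b := fun a b h => he h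
  have a1 := hm w v
  have a2 := hm v w
  have a3 := hm w y
  have a4 := hm y w
  have a5 := hm v y
  have a6 : (w : ℕ) = v → (e w : ℕ) = e v := fun h => by rw [Fin.ext h]
  have a7 : (w : ℕ) = y → (e w : ℕ) = e y := fun h => by rw [Fin.ext h]
  have := w.2
  have := (e v).2
  have := (e w).2
  unfold pos
  by_cases b1 : (v : ℕ) + 1 = M <;> by_cases b2 : (x : ℕ) + 1 = N <;>
    simp only [b1, b2, if_true, if_false] at h1 h2
  all_goals split_ifs <;> omega

end Position

namespace CurveDiagram

variable {D E : CurveDiagram}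

/-- The first passages of the pairs of consecutive passages which are removed in a move `1b` or
`s2b`. -/
structure Removable (D : CurveDiagram) (I : Finset (Fin (2 * D.n))) : Prop where
  notMem : ∀ x ∈ I, finRotate _ x ∉ I
  exists_partner : ∀ x ∈ I, ∃ y ∈ I, D.partner x = finRotate _ y ∧ D.partner y = finRotate _ x ∧
    D.left x = D.left y

/-- An edge of the smaller curve is a chain of edges of the larger one. A cycle is lifted along
these chains and bounded there; the bounding function descends because its jumps at two consecutive
removed passages cancel. -/
theorem CyclesBound.removal {K : Type*} [Ring K] (hD : D.CyclesBound K) (hE : E.n ≠ 0)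
    {e : Fin (2 * E.n) → Fin (2 * D.n)} (he : StrictMono e) {I : Finset (Fin (2 * D.n))}
    (hI : D.Removable I) (hr : ∀ x, x ∈ Set.range e ↔ ¬ (x ∈ I ∨ (finRotate _).symm x ∈ I))
    (hp : ∀ i, e (E.partner i) = D.partner (e i)) (hl : ∀ i, E.left i = D.left (e i)) :
    E.CyclesBound K := by
  intro z' hz'
  have : Nonempty (Fin (2 * E.n)) := ⟨⟨0, by omega⟩⟩
  -- `ρ x` is the last kept passage at or before `x`, that is, the edge of `E` which contains the
  -- edge `x` of `D`.
  choose ρ hρ using fun x : Fin (2 * D.n) => Finite.exists_min fun y => pos (e y) x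
  have huniq : ∀ x y, (∀ w, pos (e y) x ≤ pos (e w) x) → ρ x = y := fun x y h =>
    he.injective (pos_left_inj (le_antisymm (hρ x y) (h _)))
  have r1 : ∀ y, ρ (e y) = y := fun y => huniq _ _ fun w => by rw [pos_self]; exact Nat.zero_le _
  have r2 : ∀ x, finRotate _ x ∉ Set.range e → ρ (finRotate _ x) = ρ x := by
    intro x hx
    refine huniq _ _ fun w => ?_
    have key : ∀ v, pos (e v) (finRotate _ x) = pos (e v) x + 1 := fun v => by
      rw [pos_finRotate, if_neg]
      intro h
      have := pos_finRotate (e v) x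
      rw [if_pos h, pos_eq_zero] at this
      exact hx ⟨v, this.symm⟩
    rw [key, key]
    exact Nat.succ_le_succ (hρ x w)
  have r3 : ∀ x y, finRotate _ x = e y → ρ x = (finRotate _).symm y := fun x y h =>
    huniq _ _ (pos_predecessor_le he h)
  have r2' : ∀ x, x ∉ Set.range e → ρ ((finRotate _).symm x) = ρ x := fun x hx => by
    have := r2 ((finRotate _).symm x)
    rw [Equiv.apply_symm_apply] at this
    exact (this hx).symm
  have r3' : ∀ y, ρ ((finRotate _).symm (e y)) = (finRotate _).symm y := fun y =>
    r3 _ _ (Equiv.apply_symm_apply _ _)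
  have hrp : ∀ x, D.partner x ∈ Set.range e ↔ x ∈ Set.range e := fun x => by
    constructor
    · rintro ⟨y, hy⟩
      exact ⟨E.partner y, by rw [hp, hy, D.partner_partner]⟩
    · rintro ⟨y, rfl⟩
      exact ⟨E.partner y, hp y⟩
  have hz : D.IsCycle fun x => z' (ρ x) := by
    intro y
    simp only
    by_cases hy : y ∈ Set.range e
    · obtain ⟨y, rfl⟩ := hy
      rw [← hp, r1, r1, r3', r3']
      exact hz' y
    · rw [r2' y hy, r2' _ (mt (hrp y).1 hy)]
  obtain ⟨h, hh, hzh⟩ := hD _ hz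
  have hIr : ∀ x ∈ I, x ∉ Set.range e := fun x hx h => (hr x).1 h (Or.inl hx)
  have hIr' : ∀ x ∈ I, finRotate _ x ∉ Set.range e := fun x hx h =>
    (hr _).1 h (Or.inr (by rwa [Equiv.symm_apply_apply]))
  -- At `x` and its successor the same edge of `E` is crossed, in opposite directions.
  have hjump : ∀ x ∈ I, h ((finRotate _).symm x, true) = h (finRotate _ x, true) := by
    intro x hx
    obtain ⟨y, hy, k1, k2, k3⟩ := hI.exists_partner x hx
    have s1 := hh.sub_eq hzh x
    have s2 := hh.sub_eq hzh (finRotate _ x)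
    have hlx : D.left (finRotate _ x) = !D.left x := by rw [← k2, D.left_partner, k3]
    have hpx : D.partner (finRotate _ x) = y := by rw [← k2, D.partner_partner]
    rw [k1, Equiv.symm_apply_apply, r2 y (hIr' y hy)] at s1
    rw [hlx, hpx, Equiv.symm_apply_apply, r2' y (hIr y hy)] at s2
    rw [← sub_eq_zero]
    have : h ((finRotate _).symm x, true) - h (finRotate _ x, true) =
      (h ((finRotate _).symm x, true) - h (x, true)) + (h (x, true) - h (finRotate _ x, true)) := by
      abel
    rw [this, s1, s2]
    cases D.left x <;> simp
  -- The walk back to the kept passage proceeds in steps of two, over a whole removed pair. Edges in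
  -- `I` are excluded: they lie between the two passages of a pair, where `h` may differ.
  have hG : ∀ k x, x ∉ I → pos (e (ρ x)) x = k → h (x, true) = h (e (ρ x), true) := by
    intro k
    induction k using Nat.strong_induction_on with
    | _ k ih =>
    intro x hx hk
    by_cases hxr : x ∈ Set.range e
    · obtain ⟨y, rfl⟩ := hxr
      rw [r1]
    · have hw : (finRotate _).symm x ∈ I := by
        by_contra h
        exact hxr ((hr x).2 (by tauto))
      set w := (finRotate _).symm x with hw'
      have hxw : x = finRotate _ w := by rw [hw', Equiv.apply_symm_apply]
      have hwI : (finRotate _).symm w ∉ I := fun h => by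
        have := hI.notMem _ h
        rw [Equiv.apply_symm_apply] at this
        exact this hw
      have e1 : ρ w = ρ x := r2' x hxr
      have e2 : ρ ((finRotate _).symm w) = ρ w := r2' w (hIr w hw)
      have p1 := pos_finRotate_symm (e (ρ x)) x
      have p2 := pos_finRotate_symm (e (ρ x)) w
      have n1 : pos (e (ρ x)) x ≠ 0 := fun h => hxr ⟨ρ x, (pos_eq_zero.1 h).symm⟩
      have n2 : pos (e (ρ x)) w ≠ 0 := fun h => hIr w hw ⟨ρ x, (pos_eq_zero.1 h).symm⟩
      rw [if_neg n1, ← hw'] at p1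
      rw [if_neg n2] at p2
      have key := ih (pos (e (ρ x)) ((finRotate _).symm w)) (by omega) _ hwI (by rw [e2, e1])
      rw [e2, e1] at key
      rw [← key, hjump w hw, ← hxw]
  have hH : ∀ x s, x ∉ I → h (x, s) = h (e (ρ x), s) := by
    intro x s hx
    have h1 := hG _ x hx rfl
    cases s
    · have h2 := hzh x
      have h3 := hzh (e (ρ x))
      rw [r1, h2, h1] at h3
      exact sub_right_injective h3
    · exact h1
  have hpred : ∀ y s, h (e ((finRotate _).symm y), s) = h ((finRotate _).symm (e y), s) := by
    intro y s
    rw [hH ((finRotate _).symm (e y)) s, r3']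
    intro hI'
    have := (hr (e y)).1 ⟨y, rfl⟩
    exact this (Or.inr hI')
  refine ⟨fun q => h (e q.1, q.2), isRegionFun_of ?_ ?_ ?_ ?_, fun y => ?_⟩
  · intro y hy
    simp only
    rw [hpred, hp, hh.left_in (by rw [← hl, hy])]
  · intro y hy
    simp only
    rw [hpred, hp, hh.left_out (by rw [← hl, hy])]
  · intro y hy
    simp only
    rw [hpred, hpred, hp, hh.right_in (by rw [← hl, hy])]
  · intro y hy
    simp only
    rw [hp, hh.right_out (by rw [← hl, hy])]
  · rw [← hzh, r1]

end CurveDiagram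

namespace KnotProjection

open CurveDiagram

/-- Removable double points can be removed. -/
theorem exists_removal (P : KnotProjection) {I : Finset (Fin (2 * P.n))}
    (hI : P.Removable I) :
    ∃ (P' : KnotProjection) (e : Fin (2 * P'.n) → Fin (2 * P.n)), StrictMono e ∧
      Set.range e = {x | x ∈ I ∨ (finRotate _).symm x ∈ I}ᶜ ∧
      (∀ i, e (P'.partner i) = P.partner (e i)) ∧ (∀ i, P'.left i = P.left (e i)) ∧
      P'.n + I.card = P.n := by
  classical
  set J := I.map (finRotate (2 * P.n)).toEmbedding with hJ
  have hmemJ : ∀ x, x ∈ J ↔ (finRotate _).symm x ∈ I := fun x => by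
    rw [hJ, Finset.mem_map_equiv]
  have hdis : Disjoint I J := by
    rw [Finset.disjoint_left]
    intro x hx hxJ
    have := hI.notMem _ ((hmemJ x).1 hxJ)
    rw [Equiv.apply_symm_apply] at this
    exact this hx
  have hcard : (I ∪ J).card = 2 * I.card := by
    rw [Finset.card_union_of_disjoint hdis, hJ, Finset.card_map]
    omega
  have hle := Finset.card_le_univ (I ∪ J)
  rw [Fintype.card_fin, hcard] at hle
  have hc : (I ∪ J)ᶜ.card = 2 * (P.n - I.card) := by
    rw [Finset.card_compl, Fintype.card_fin, hcard]
    omega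
  set e := (I ∪ J)ᶜ.orderEmbOfFin hc with he
  have hrange : Set.range e = {x | x ∈ I ∨ (finRotate _).symm x ∈ I}ᶜ := by
    rw [he, Finset.range_orderEmbOfFin]
    ext x
    simp [hmemJ]
  have hs : ∀ x, (x ∈ I ∨ (finRotate _).symm x ∈ I) →
      (P.partner x ∈ I ∨ (finRotate _).symm (P.partner x) ∈ I) := by
    rintro x (h | h)
    · obtain ⟨y, hy, k1, -, -⟩ := hI.exists_partner x h
      exact Or.inr (by rwa [k1, Equiv.symm_apply_apply])
    · obtain ⟨y, hy, -, k2, -⟩ := hI.exists_partner _ h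
      rw [Equiv.apply_symm_apply] at k2
      exact Or.inl (by rwa [← k2, P.partner_partner])
  have hex : ∀ i, ∃ j, e j = P.partner (e i) := by
    intro i
    have h1 : e i ∈ Set.range e := ⟨i, rfl⟩
    show P.partner (e i) ∈ Set.range e
    rw [hrange] at h1 ⊢
    intro h2
    have h3 := hs _ h2
    rw [P.partner_partner] at h3
    exact h1 h3
  choose q hq using hex
  let E : CurveDiagram :=
    { n := P.n - I.card
      partner := q
      partner_partner := fun i => e.injective (by rw [hq, hq, P.partner_partner])
      partner_ne := fun i h => P.partner_ne (e i) (by rw [← hq, h])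
      left := fun i => P.left (e i)
      left_partner := fun i => by rw [hq, P.left_partner] }
  refine ⟨{ E with sphere := fun hn => ?_ }, e, e.strictMono, hrange, hq, fun _ => rfl, ?_⟩
  · have hP : P.n ≠ 0 := by
      have : P.n - I.card ≠ 0 := hn
      omega
    refine (E.sphere_iff_cyclesBound ℚ hn).2 ?_
    refine (P.cyclesBound hP ℚ).removal hn (e := e) e.strictMono hI (fun x => ?_) hq fun _ => rfl
    rw [hrange]
    rfl
  · show P.n - I.card + I.card = P.n
    omega

theorem tripleChords_eq_zero_iff (P : KnotProjection) : P.tripleChords = 0 ↔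
    ∀ x y z : Fin (2 * P.n), x < y → y < z → z < P.partner x → P.partner x < P.partner y →
      ¬ P.partner y < P.partner z := by
  rw [tripleChords, Finset.card_eq_zero, Finset.filter_eq_empty_iff]
  constructor
  · intro h x y z h1 h2 h3 h4 h5
    exact h (Finset.mem_univ (x, y, z)) ⟨h1, h2, h3, h4, h5⟩
  · rintro h ⟨x, y, z⟩ - ⟨h1, h2, h3, h4, h5⟩
    exact h x y z h1 h2 h3 h4 h5

theorem tripleChords_of_removal {P P' : KnotProjection} (h : P.tripleChords = 0)
    {e : Fin (2 * P'.n) → Fin (2 * P.n)} (he : StrictMono e)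
    (hp : ∀ i, e (P'.partner i) = P.partner (e i)) : P'.tripleChords = 0 := by
  rw [tripleChords_eq_zero_iff] at h ⊢
  intro x y z h1 h2 h3 h4 h5
  refine h (e x) (e y) (e z) (he h1) (he h2) ?_ ?_ ?_
  all_goals rw [← hp]
  · exact he h3
  · rw [← hp]; exact he h4
  · rw [← hp]; exact he h5

theorem exists_move1b (P : KnotProjection) (h : P.tripleChords = 0) {i : Fin (2 * P.n)}
    (hi : P.partner i = finRotate _ i) :
    ∃ P', Move1b P P' ∧ P'.n < P.n ∧ P'.tripleChords = 0 := by
  have hne : finRotate _ i ≠ i := fun h => P.partner_ne i (hi.trans h)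
  have hI : P.Removable {i} := by
    constructor
    · intro x hx
      rw [Finset.mem_singleton] at hx ⊢
      rwa [hx]
    · intro x hx
      rw [Finset.mem_singleton] at hx
      exact ⟨i, Finset.mem_singleton_self _, by rw [hx, hi], by rw [hx, hi], by rw [hx]⟩
  obtain ⟨P', e, he, hr, hp, hl, hc⟩ := P.exists_removal hI
  obtain ⟨s, hs⟩ := turn_eq_self_iff.2 hi
  refine ⟨P', ⟨i, s, hs, e, ⟨0, he⟩, ?_, hp, hl⟩, ?_, tripleChords_of_removal h he hp⟩
  · rw [hr]
    congr 1
    ext x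
    simp only [Finset.mem_singleton, Equiv.symm_apply_eq, Set.mem_ofPred_eq, Set.mem_insert_iff,
      Set.mem_singleton_iff]
  · rw [Finset.card_singleton] at hc
    omega

theorem exists_moveS2b (P : KnotProjection) (h : P.tripleChords = 0) {i j : Fin (2 * P.n)}
    (hij : i ≠ j) (hi : P.partner i = finRotate _ j) (hj : P.partner j = finRotate _ i)
    (hlr : P.left i = P.left j) :
    ∃ P', MoveS2b P P' ∧ P'.n < P.n ∧ P'.tripleChords = 0 := by
  have hne : ∀ x : Fin (2 * P.n), finRotate _ x ≠ x := fun x hx => by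
    have h1 := val_finRotate x
    rw [hx] at h1
    split_ifs at h1 <;> omega
  have hI : P.Removable {i, j} := by
    constructor
    · intro x hx
      rw [Finset.mem_insert, Finset.mem_singleton] at hx ⊢
      rcases hx with rfl | rfl
      · exact not_or.2 ⟨hne _, fun h => P.partner_ne j (hj.trans h)⟩
      · exact not_or.2 ⟨fun h => P.partner_ne i (hi.trans h), hne _⟩
    · intro x hx
      rw [Finset.mem_insert, Finset.mem_singleton] at hx
      rcases hx with rfl | rfl
      · exact ⟨j, by simp, hi, hj, hlr⟩
      · exact ⟨i, by simp, hj, hi, hlr.symm⟩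
  obtain ⟨P', e, he, hr, hp, hl, hc⟩ := P.exists_removal hI
  obtain ⟨s, hs, hs'⟩ := exists_turn_iff.2 ⟨hi, hj, hlr⟩
  refine ⟨P', ⟨i, j, s, hij, hs, hs', e, ⟨0, he⟩, ?_, hp, hl⟩, ?_, tripleChords_of_removal h he hp⟩
  · rw [hr]
    congr 1
    ext x
    simp only [Finset.mem_insert, Finset.mem_singleton, Equiv.symm_apply_eq, Set.mem_ofPred_eq,
      Set.mem_insert_iff, Set.mem_singleton_iff]
    tauto
  · rw [Finset.card_insert_of_notMem (by simpa using hij), Finset.card_singleton] at hc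
    omega

end KnotProjection

/-! ### Sets of regions and cyclic triple-freeness. -/

namespace CurveDiagram

variable {D : CurveDiagram}

/-- The function `h` does not change across the edge `e`. -/
abbrev Flat {β α : Type*} (h : β × Bool → α) (e : β) : Prop := h (e, true) = h (e, false)

section Flat

variable {α : Type*} {h : Fin (2 * D.n) × Bool → α} (hh : D.IsRegionFun h)
include hh

theorem IsRegionFun.cross_iff {y : Fin (2 * D.n)} (f1 : Flat h ((finRotate _).symm y))
    (f2 : Flat h y) :
    h ((finRotate _).symm y, true) = h (y, true) ↔ Flat h (D.partner y) := by
  have hp := D.partner_partner y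
  unfold Flat at *
  cases hl : D.left y
  · have e1 := hh.left_out (left_partner_of_false hl)
    have e2 := hh.right_out hl
    rw [hp] at e1
    rw [e1, ← e2, ← f1, ← f2]
    exact eq_comm
  · have e1 := hh.left_in hl
    have e2 := hh.right_out (left_partner_of_true hl)
    rw [hp] at e2
    rw [e1, e2]

theorem IsRegionFun.in_out {y : Fin (2 * D.n)} (f1 : Flat h ((finRotate _).symm y))
    (f2 : Flat h (D.partner y)) : h ((finRotate _).symm y, true) = h (D.partner y, true) := by
  cases hl : D.left y
  · have e1 := hh.left_out (left_partner_of_false hl)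
    rw [D.partner_partner] at e1
    rw [f1, f2, e1]
  · exact hh.left_in hl

theorem IsRegionFun.out_out {y : Fin (2 * D.n)} (f1 : Flat h y)
    (f2 : Flat h (D.partner y)) : h (y, true) = h (D.partner y, true) := by
  cases hl : D.left y
  · rw [f1, hh.right_out hl]
  · have e1 := hh.right_out (left_partner_of_true hl)
    rw [D.partner_partner] at e1
    rw [f2, e1]

theorem IsRegionFun.arc_const {b : Fin (2 * D.n)} {S E : ℕ}
    (hf : ∀ e, S ≤ pos b e → pos b e ≤ E → Flat h e)
    (hp : ∀ y, S < pos b y → pos b y ≤ E → Flat h (D.partner y)) {x y : Fin (2 * D.n)}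
    (hx : S ≤ pos b x) (hx' : pos b x ≤ E) (hy : S ≤ pos b y) (hy' : pos b y ≤ E) :
    h (x, true) = h (y, true) := by
  refine eq_of_arc_invariant (f := fun x => h (x, true)) (b := b) (s := S) (t := E)
    (fun w h1 h2 h3 => ?_) hx hx' hy hy'
  have hw := pos_finRotate b w
  rw [if_neg (by omega)] at hw
  have := hh.cross_iff (y := finRotate _ w) (by
    rw [Equiv.symm_apply_apply]; exact hf _ h1 (by omega)) (hf _ (by omega) (by omega))
  rw [Equiv.symm_apply_apply] at this
  exact (this.2 (hp _ (by omega) (by omega))).symm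

end Flat

/-- A cycle bounds a set of regions. -/
theorem CyclesBound.exists_regions (hD : D.CyclesBound (ZMod 2)) {Z : Fin (2 * D.n) → Prop}
    [DecidablePred Z] (hZ : D.IsCycle fun e => if Z e then (1 : ZMod 2) else 0)
    (q : Fin (2 * D.n) × Bool) :
    ∃ h : Fin (2 * D.n) × Bool → Bool, D.IsRegionFun h ∧ (∀ e, Flat h e ↔ ¬ Z e) ∧
      h q = false := by
  obtain ⟨h, hh, hz⟩ := hD _ hZ
  refine ⟨fun r => decide (h r ≠ h q), fun r => by simp only [hh r], fun e => ?_, by simp⟩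
  have h1 := hz e
  have two : ∀ a b c : ZMod 2, (decide (a ≠ c) = decide (b ≠ c)) ↔ a - b = 0 := by decide
  unfold Flat
  rw [two, ← h1]
  split_ifs with h2 <;> simp [h2]

/-- A smaller set of regions, recognized at the edges. -/
theorem card_lt_of_regions {h h' : Fin (2 * D.n) × Bool → Bool} (hh : D.IsRegionFun h)
    (hh' : D.IsRegionFun h')
    (he : ∀ e, (Flat h e ∧ Flat h' e) ∨ ∀ s, h' (e, s) = true → h (e, s) = true)
    {q : Fin (2 * D.n) × Bool} (hq : h q = true) (hq' : h' q = false) :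
    (Finset.univ.filter fun r => h' r = true).card <
      (Finset.univ.filter fun r => h r = true).card := by
  -- The set difference is flat across every edge, hence constant, and it is false at `q`; this
  -- gives the inclusion.
  have hg : D.IsRegionFun fun r => h' r && !h r := fun r => by simp only [hh r, hh' r]
  have key := hg.eq_of_flat (fun e => by
    show (h' (e, true) && !h (e, true)) = (h' (e, false) && !h (e, false))
    rcases he e with ⟨h1, h2⟩ | h1
    · rw [h1, h2]
    · have a := h1 true
      have b := h1 false
      generalize h' (e, true) = u at *
      generalize h' (e, false) = v at *
      generalize h (e, true) = w at *
      generalize h (e, false) = x at *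
      revert u v w x
      decide) q
  apply Finset.card_lt_card
  rw [Finset.ssubset_iff_of_subset]
  · exact ⟨q, by simpa using hq, by simp [hq']⟩
  · intro r hr
    have := key r
    simp only [hq, hq', Finset.mem_filter, Finset.mem_univ, true_and] at this hr ⊢
    rw [hr] at this
    simpa using this

/-- No three chords cross each other. -/
def TripleFree (D : CurveDiagram) : Prop :=
  ∀ b x y z : Fin (2 * D.n), pos b x < pos b y → pos b y < pos b z →
    pos b z < pos b (D.partner x) → pos b (D.partner x) < pos b (D.partner y) →
    pos b (D.partner y) < pos b (D.partner z) → False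

/-- The six ends of a triple chord remain alternating from any base point. The six instances of `h`
correspond to the end that is met first from `0`. -/
theorem tripleFree_of (h : ∀ x y z : Fin (2 * D.n), x < y → y < z → z < D.partner x →
    D.partner x < D.partner y → ¬ D.partner y < D.partner z) : D.TripleFree := by
  intro b x y z h1 h2 h3 h4 h5
  have px := D.partner_partner x
  have py := D.partner_partner y
  have pz := D.partner_partner z
  have t1 := h x y z
  have t2 := h y z (D.partner x)
  have t3 := h z (D.partner x) (D.partner y)
  have t4 := h (D.partner x) (D.partner y) (D.partner z)
  have t5 := h (D.partner y) (D.partner z) x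
  have t6 := h (D.partner z) x y
  rw [px] at t2 t3 t4
  rw [py] at t3 t4 t5
  rw [pz] at t4 t5 t6
  simp only [Fin.lt_def] at t1 t2 t3 t4 t5 t6
  have b1 := x.2
  have b2 := y.2
  have b3 := z.2
  have b4 := (D.partner x).2
  have b5 := (D.partner y).2
  have b6 := (D.partner z).2
  unfold pos at *
  generalize (D.partner x : ℕ) = p at *
  generalize (D.partner y : ℕ) = q at *
  generalize (D.partner z : ℕ) = r at *
  generalize (x : ℕ) = x at *
  generalize (y : ℕ) = y at *
  generalize (z : ℕ) = z at *
  clear px py pz h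
  split_ifs at * <;> omega

end CurveDiagram

/-! ### Disks, and strands crossing them. -/

namespace CurveDiagram

variable {D : CurveDiagram}

/-- A disk formed by the regions on which `h` is true.  It is bounded by a simple arc of the curve
from the passage `b` to the passage `c`, which is closed either by a double point or by one further
edge, walked along the orientation, and it has convex corners. -/
structure Disk (D : CurveDiagram) (b c : Fin (2 * D.n)) (R : Fin (2 * D.n) → Prop)
    (h : Fin (2 * D.n) × Bool → Bool) : Prop where
  region : D.IsRegionFun h
  pos_pos : 0 < pos b c
  flat_iff : ∀ e, Flat h e ↔ ¬ (pos b e < pos b c ∨ R e)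
  simple : ∀ x, 0 < pos b x → pos b x < pos b c → pos b c < pos b (D.partner x)
  outer_start : h ((finRotate _).symm b, true) = false
  outer_end : h (c, true) = false
  closed : (D.partner b = c ∧ ∀ e, ¬ R e) ∨
    ∃ a, pos b c < pos b a ∧ pos b a + 1 < 2 * D.n ∧ D.partner c = a ∧
      D.partner b = finRotate _ a ∧ (∀ e, R e ↔ e = a) ∧
      h ((finRotate _).symm a, true) = false ∧ h (finRotate _ a, true) = false

/-- A part of the curve which crosses a disk, from the passage `v` to the passage `u`, where the
partners of `u` and `v` are consecutive passages of the arc bounding the disk. -/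
structure Strand (D : CurveDiagram) (b c : Fin (2 * D.n)) (h : Fin (2 * D.n) × Bool → Bool)
    (v u : Fin (2 * D.n)) : Prop where
  lt_end : pos b c < pos b v
  lt : pos b v < pos b u
  pos_pos : 0 < pos b (D.partner u)
  succ : D.partner v = finRotate _ (D.partner u)
  pos_lt_pos : pos b (D.partner u) < pos b (D.partner v)
  pos_lt : pos b (D.partner v) < pos b c
  inner : ∀ e s, pos b v ≤ pos b e → pos b e < pos b u → h (e, s) = true
  partner_inner : ∀ y, pos b v < pos b y → pos b y < pos b u → pos b c < pos b (D.partner y)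

section Disk

variable {b c : Fin (2 * D.n)} {R : Fin (2 * D.n) → Prop} {h : Fin (2 * D.n) × Bool → Bool}

/-- The last passage of the curve through a disk, on the way from one corner to the next one. -/
theorem Disk.exists_last (hd : D.Disk b c R h) {S E : ℕ} (hS : pos b c ≤ S) (hE : E ≤ 2 * D.n)
    (hflat : ∀ e, S ≤ pos b e → pos b e < E → Flat h e)
    (hpart : ∀ y, S < pos b y → pos b y < E → pos b (D.partner y) ≠ 0 ∧
      pos b (D.partner y) ≠ pos b c ∧ ¬ R (D.partner y))
    (hs : ∀ e, pos b e = S → h (e, true) = false)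
    (he : ∀ e, pos b e + 1 = E → h (e, true) = false)
    (hcross : ∀ x w : Fin (2 * D.n), 0 < pos b x → pos b x < pos b w → pos b w < pos b c →
      S < pos b (D.partner x) → pos b (D.partner x) < pos b (D.partner w) →
      pos b (D.partner w) < E → False)
    (hex : ∃ y, S < pos b y ∧ pos b y < E ∧ pos b (D.partner y) < pos b c) :
    ∃ v u, S < pos b v ∧ pos b v < pos b u ∧ pos b u < E ∧
      0 < pos b (D.partner u) ∧ pos b (D.partner u) < pos b (D.partner v) ∧
      pos b (D.partner v) < pos b c ∧
      (∀ e s, pos b v ≤ pos b e → pos b e < pos b u → h (e, s) = true) ∧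
      (∀ y, pos b v < pos b y → pos b y < pos b u → pos b c < pos b (D.partner y)) ∧
      ∀ x, 0 < pos b x → pos b x < pos b (D.partner v) → S < pos b (D.partner x) →
        pos b (D.partner x) < E → x = D.partner u := by
  classical
  have hflatp : ∀ y, S < pos b y → pos b y < E →
      (Flat h (D.partner y) ↔ ¬ pos b (D.partner y) < pos b c) := fun y h1 h2 => by
    rw [hd.flat_iff]
    have := (hpart y h1 h2).2.2
    tauto
  set T := Finset.univ.filter fun y => S < pos b y ∧ pos b y < E ∧ pos b (D.partner y) < pos b c
    with hT
  have hmem : ∀ y, y ∈ T ↔ S < pos b y ∧ pos b y < E ∧ pos b (D.partner y) < pos b c := fun y => by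
    simp [hT]
  -- After the last meeting with the arc the curve is outside, so the disk is left at `u`. As the
  -- stretch also starts outside, there is an earlier meeting; the last one is the entrance `v`.
  obtain ⟨u, hu, humax⟩ := T.exists_max_image (pos b) (by
    obtain ⟨y, hy⟩ := hex
    exact ⟨y, (hmem y).2 hy⟩)
  obtain ⟨u1, u2, u3⟩ := (hmem u).1 hu
  obtain ⟨l, hl⟩ := exists_pos_eq b (t := E - 1) (by omega)
  obtain ⟨f, hf⟩ := exists_pos_eq b (t := S) (by omega)
  have hul : h (u, true) = false := by
    rw [← he l (by omega)]
    refine hd.region.arc_const (b := b) (S := pos b u) (E := E - 1)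
      (fun e h1 h2 => hflat e (by omega) (by omega)) (fun y h1 h2 => ?_)
      le_rfl (by omega) (by omega) (by omega)
    rw [hflatp y (by omega) (by omega)]
    intro h3
    have := humax y ((hmem y).2 ⟨by omega, by omega, h3⟩)
    omega
  have hpu := pos_finRotate_symm b u
  rw [if_neg (by omega)] at hpu
  have cross : ∀ y, S < pos b y → pos b y < E →
      (h ((finRotate _).symm y, true) = h (y, true) ↔ ¬ pos b (D.partner y) < pos b c) := by
    intro y h1 h2
    have hpy := pos_finRotate_symm b y
    rw [if_neg (by omega)] at hpy
    rw [hd.region.cross_iff (hflat _ (by omega) (by omega)) (hflat _ (by omega) (by omega)),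
      hflatp y h1 h2]
  have hpu' : h ((finRotate _).symm u, true) = true := by
    have := mt (cross u u1 u2).1 (not_not.2 u3)
    rw [hul] at this
    simpa using this
  set T' := T.filter fun y => pos b y < pos b u with hT'
  have hmem' : ∀ y, y ∈ T' ↔ y ∈ T ∧ pos b y < pos b u := fun y => by simp [hT']
  have hne : T'.Nonempty := by
    by_contra hemp
    rw [Finset.not_nonempty_iff_eq_empty] at hemp
    have : h (f, true) = h ((finRotate _).symm u, true) := by
      refine hd.region.arc_const (b := b) (S := S) (E := pos b u - 1)
        (fun e h1 h2 => hflat e (by omega) (by omega)) (fun y h1 h2 => ?_)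
        (by omega) (by omega) (by omega) (by omega)
      rw [hflatp y (by omega) (by omega)]
      intro h3
      have : y ∈ T' := (hmem' y).2 ⟨(hmem y).2 ⟨by omega, by omega, h3⟩, by omega⟩
      rw [hemp] at this
      simp at this
    rw [hs f hf, hpu'] at this
    simp at this
  obtain ⟨v, hv, hvmax⟩ := T'.exists_max_image (pos b) hne
  obtain ⟨hv', v4⟩ := (hmem' v).1 hv
  obtain ⟨v1, v2, v3⟩ := (hmem v).1 hv'
  have hin : ∀ y, pos b v < pos b y → pos b y < pos b u → ¬ pos b (D.partner y) < pos b c := by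
    intro y h1 h2 h3
    have := hvmax y ((hmem' y).2 ⟨(hmem y).2 ⟨by omega, by omega, h3⟩, h2⟩)
    omega
  have hinner : ∀ e, pos b v ≤ pos b e → pos b e < pos b u → h (e, true) = true := by
    intro e h1 h2
    refine (hd.region.arc_const (b := b) (S := pos b v) (E := pos b u - 1)
      (fun e h1 h2 => hflat e (by omega) (by omega)) (fun y h1 h2 => ?_)
      (by omega) (by omega) (by omega) (by omega)).trans hpu'
    rw [hflatp y (by omega) (by omega)]
    exact hin y (by omega) (by omega)
  have hboth : ∀ e t, S ≤ pos b e → pos b e < E → h (e, true) = t → ∀ s, h (e, s) = t := by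
    intro e t h1 h2 h3 s
    have := hflat e h1 h2
    cases s
    · exact this.symm.trans h3
    · exact h3
  have hpu0 := (hpart u u1 u2).1
  have hpv0 := (hpart v v1 v2).1
  have huv : D.partner u ≠ D.partner v := fun h => by
    rw [D.partner_injective h] at v4
    exact lt_irrefl _ v4
  -- By `hcross`, chords from the arc to this stretch meet their ends in reversed order.
  have hlt : pos b (D.partner u) < pos b (D.partner v) := by
    rcases lt_trichotomy (pos b (D.partner u)) (pos b (D.partner v)) with h | h | h
    · exact h
    · exact absurd (pos_inj.1 h) huv
    · refine (hcross (D.partner v) (D.partner u) (by omega) h u3 ?_ ?_ ?_).elim <;>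
        simp only [D.partner_partner] <;> omega
  refine ⟨v, u, v1, v4, u2, by omega, hlt, v3, fun e s h1 h2 => hboth e _ (by omega) (by omega)
    (hinner e h1 h2) s, fun y h1 h2 => ?_, fun x x1 x2 x3 x4 => ?_⟩
  · have h3 := hin y h1 h2
    have h4 := (hpart y (by omega) (by omega)).2.1
    omega
  · have hxT : D.partner x ∈ T := (hmem _).2 ⟨x3, x4, by rw [D.partner_partner]; omega⟩
    have hxu := humax _ hxT
    by_contra hxne
    have hne1 : pos b (D.partner x) ≠ pos b u := fun h => hxne (by
      rw [← pos_inj.1 h, D.partner_partner])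
    have hne2 : pos b (D.partner x) ≠ pos b v := fun h => by
      rw [← pos_inj.1 h, D.partner_partner] at x2
      exact lt_irrefl _ x2
    have hxv := hvmax (D.partner x)
    have : pos b (D.partner x) < pos b v := by
      have := hxv ((hmem' _).2 ⟨hxT, by omega⟩)
      omega
    refine hcross x (D.partner v) x1 x2 v3 x3 ?_ ?_ <;> simp only [D.partner_partner] <;> omega

/-- Two chords from the arc to the same stretch between corners cannot cross each other: both cross
the chord of a corner. So the last passage through the disk runs backwards along the arc. It remains
to exclude arc passages between its ends. -/
theorem Disk.exists_strand (hB : D.CyclesBound (ZMod 2)) (hT : D.TripleFree)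
    (hd : D.Disk b c R h) (hL : 1 < pos b c) : ∃ v u, D.Strand b c h v u := by
  have hb0 := pos_self b
  have hcN := pos_lt b c
  have hcb := hd.pos_pos
  have hout : ∀ x, pos b x = 2 * D.n - 1 → h (x, true) = false := fun x hx => by
    have h1 := pos_finRotate_symm b b
    rw [if_pos hb0] at h1
    have : x = (finRotate _).symm b := pos_inj.1 (hx.trans h1.symm)
    rw [this]
    exact hd.outer_start
  have hsucc : ∀ v u : Fin (2 * D.n), pos b (D.partner u) < pos b (D.partner v) →
      (∀ x, ¬ (pos b (D.partner u) < pos b x ∧ pos b x < pos b (D.partner v))) →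
      D.partner v = finRotate _ (D.partner u) := by
    intro v u h1 h2
    refine eq_of_pos_succ (b := b) ?_
    by_contra h3
    have := pos_lt b (D.partner v)
    obtain ⟨w, hw⟩ := exists_pos_eq b (t := pos b (D.partner u) + 1) (by omega)
    exact h2 w (by omega)
  obtain ⟨w, hw⟩ := exists_pos_eq b (t := 1) (by omega)
  have hwc := hd.simple w (by omega) (by omega)
  rcases hd.closed with ⟨hbc, hR⟩ | ⟨a, a1, a2, a3, a4, hR, a5, a6⟩
  · obtain ⟨v, u, k1, k2, k3, k4, k5, k6, k7, k8, k9⟩ := hd.exists_last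
      (S := pos b c) (E := 2 * D.n) le_rfl le_rfl
      (fun e h1 h2 => (hd.flat_iff e).2 (by
        rintro (h | h)
        · omega
        · exact hR e h))
      (fun y h1 h2 => by
        refine ⟨fun h => ?_, fun h => ?_, hR _⟩
        · have := pos_eq_zero.1 h
          rw [← hbc, ← this, D.partner_partner] at h1
          exact lt_irrefl _ h1
        · rw [← hbc] at h
          have := D.partner_injective (pos_inj.1 h)
          rw [this] at h1
          omega)
      (fun e h => by rw [pos_inj.1 h]; exact hd.outer_end)
      (fun e h => hout e (by omega))
      (fun x w h1 h2 h3 h4 h5 h6 => hT b b x w (by omega) h2 (by rwa [hbc]) (by rwa [hbc]) h5)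
      ⟨D.partner w, hwc, pos_lt _ _, by rw [D.partner_partner]; omega⟩
    refine ⟨v, u, k1, k2, k4, hsucc v u k5 fun x hx => ?_, k5, k6, k7, k8⟩
    have := k9 x (by omega) hx.2 (hd.simple x (by omega) (by omega)) (pos_lt _ _)
    rw [this] at hx
    omega
  · have ha' : pos b (finRotate _ a) = pos b a + 1 := by rw [pos_finRotate, if_neg (by omega)]
    have hpa : D.partner a = c := by rw [← a3, D.partner_partner]
    have hpa' : D.partner (finRotate _ a) = b := by rw [← a4, D.partner_partner]
    have hflat : ∀ e, pos b c ≤ pos b e → e ≠ a → Flat h e := fun e h1 h2 =>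
      (hd.flat_iff e).2 (by
        rintro (h | h)
        · omega
        · exact h2 ((hR e).1 h))
    have hpart : ∀ y, pos b c < pos b y → y ≠ a → y ≠ finRotate _ a →
        pos b (D.partner y) ≠ 0 ∧ pos b (D.partner y) ≠ pos b c ∧ ¬ R (D.partner y) := by
      intro y h1 h2 h3
      refine ⟨fun h => h3 ?_, fun h => h2 ?_, fun h => ?_⟩
      · rw [← a4, ← pos_eq_zero.1 h, D.partner_partner]
      · rw [← a3, ← pos_inj.1 h, D.partner_partner]
      · have := (hR _).1 h
        rw [← D.partner_partner y, this, hpa] at h1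
        exact lt_irrefl _ h1
    have hne : ∀ x y : Fin (2 * D.n), pos b x ≠ pos b y → x ≠ y := fun x y h h' => h (by rw [h'])
    -- With a second closing edge, the rest of the curve consists of two stretches, from `c` to `a`
    -- and from the successor of `a` to `b`. The first is preferred if it meets the arc.
    by_cases hII : ∃ y, pos b c < pos b y ∧ pos b y < pos b a ∧ pos b (D.partner y) < pos b c
    · have hpa0 := pos_finRotate_symm b a
      rw [if_neg (by omega)] at hpa0
      obtain ⟨v, u, k1, k2, k3, k4, k5, k6, k7, k8, k9⟩ := hd.exists_last
        (S := pos b c) (E := pos b a) le_rfl (by omega)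
        (fun e h1 h2 => hflat e h1 (hne _ _ (by omega)))
        (fun y h1 h2 => hpart y h1 (hne _ _ (by omega)) (hne _ _ (by omega)))
        (fun e h => by rw [pos_inj.1 h]; exact hd.outer_end)
        (fun e h => by
          have : e = (finRotate _).symm a := (pos_inj (b := b)).1 (by omega)
          rw [this]
          exact a5)
        (fun x w h1 h2 h3 h4 h5 h6 => hT b x w c h2 h3 h4 h5 (by rwa [a3]))
        hII
      refine ⟨v, u, k1, k2, k4, hsucc v u k5 fun x hx => ?_, k5, k6, k7, k8⟩
      have hxc := hd.simple x (by omega) (by omega)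
      have hxa : pos b a + 1 < pos b (D.partner x) := by
        by_contra hcon
        have n1 : pos b (D.partner x) ≠ pos b a := fun h => by
          have := congrArg D.partner (pos_inj.1 h)
          rw [D.partner_partner, hpa] at this
          rw [this] at hx
          omega
        have n2 : pos b (D.partner x) ≠ pos b a + 1 := fun h => by
          rw [← ha'] at h
          have := congrArg D.partner (pos_inj.1 h)
          rw [D.partner_partner, hpa'] at this
          rw [this] at hx
          omega
        have := k9 x (by omega) hx.2 hxc (by omega)
        rw [this] at hx
        omega
      have hpx : ∀ e, pos (D.partner x) e = if pos b (D.partner x) ≤ pos b e then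
        pos b e - pos b (D.partner x) else pos b e + 2 * D.n - pos b (D.partner x) :=
        fun e => pos_change b _ e
      have hpc : ∀ e, pos c e = if pos b c ≤ pos b e then
        pos b e - pos b c else pos b e + 2 * D.n - pos b c := fun e => pos_change b _ e
      have hxN := pos_lt b (D.partner x)
      have hz : ∀ e, (pos (D.partner x) e < pos (D.partner x) (D.partner (D.partner x))) ↔
          (pos b (D.partner x) ≤ pos b e ∨ pos b e < pos b x) := fun e => by
        have := pos_lt b e
        rw [D.partner_partner, hpx, hpx]
        split_ifs <;> omega
      -- An arc passage `x` between the ends could only have its partner on the other stretch. Then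
      -- the loop from `partner x` through `b` to `x` and the loop from `c` to `a` would be disjoint
      -- cycles meeting only at `u`: an odd number of times. Further meetings are excluded by `k9`
      -- or by the triple chord of `b`, `x`, `y`.
      have sum := hB.loop_sum (D.isCycle_arc (D.partner x)) c (fun e he => by
        rw [if_neg]
        rw [hz]
        rw [a3, hpc, hpc] at he
        have := pos_lt b e
        split_ifs at he <;> omega)
      have term : ∀ y, (if 0 < pos c y ∧ pos c y < pos c (D.partner c) then
          (if D.left y then
            (if pos (D.partner x) (D.partner y) < pos (D.partner x) (D.partner (D.partner x))
              then (1 : ZMod 2) else 0) else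
          - (if pos (D.partner x) ((finRotate _).symm (D.partner y)) <
            pos (D.partner x) (D.partner (D.partner x)) then (1 : ZMod 2) else 0)) else 0) =
          if y = u then 1 else 0 := by
        intro y
        have hyN := pos_lt b y
        have hiff : (0 < pos c y ∧ pos c y < pos c (D.partner c)) ↔
            (pos b c < pos b y ∧ pos b y < pos b a) := by
          rw [a3, hpc, hpc]
          split_ifs <;> omega
        by_cases hy : pos b c < pos b y ∧ pos b y < pos b a
        · rw [if_pos (hiff.2 hy)]
          obtain ⟨n0, n1, -⟩ := hpart y hy.1 (hne _ _ (by omega)) (hne _ _ (by omega))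
          have hpy := pos_finRotate_symm b (D.partner y)
          rw [if_neg n0] at hpy
          have nx : pos b (D.partner y) ≠ pos b x := fun h => by
            rw [← pos_inj.1 h, D.partner_partner] at hxa
            omega
          have npx : pos b (D.partner y) ≠ pos b (D.partner x) := fun h => by
            rw [D.partner_injective (pos_inj.1 h)] at hy
            omega
          have hT1 : ¬ pos b (D.partner x) < pos b (D.partner y) := fun h =>
            hT b b x y (by omega) (by omega) (by rw [a4]; omega) (by rw [a4]; omega) h
          have e1 : (pos (D.partner x) (D.partner y) <
              pos (D.partner x) (D.partner (D.partner x))) ↔ y = u := by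
            rw [hz]
            constructor
            · rintro (h | h)
              · omega
              · have := k9 (D.partner y) (by omega) (by omega) (by rw [D.partner_partner]; omega)
                  (by rw [D.partner_partner]; omega)
                exact D.partner_injective this
            · rintro rfl
              omega
          have e2 : (pos (D.partner x) ((finRotate _).symm (D.partner y)) <
              pos (D.partner x) (D.partner (D.partner x))) ↔ y = u := by
            rw [← e1, hz, hz, hpy]
            omega
          simp only [e1, e2]
          split_ifs <;> decide
        · rw [if_neg (mt hiff.1 hy), if_neg]
          rintro rfl
          omega
      rw [Finset.sum_congr rfl fun y _ => term y, Finset.sum_ite_eq', if_pos (Finset.mem_univ _)]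
        at sum
      exact one_ne_zero sum
    · have hI : ∀ x, 0 < pos b x → pos b x < pos b c → pos b a + 1 < pos b (D.partner x) := by
        intro x x1 x2
        have hxc := hd.simple x x1 x2
        by_contra hcon
        have n1 : pos b (D.partner x) ≠ pos b a := fun h => by
          have := congrArg D.partner (pos_inj.1 h)
          rw [D.partner_partner, hpa] at this
          rw [this] at x2
          omega
        have n2 : pos b (D.partner x) ≠ pos b a + 1 := fun h => by
          rw [← ha'] at h
          have := congrArg D.partner (pos_inj.1 h)
          rw [D.partner_partner, hpa'] at this
          rw [this] at x1
          omega
        exact hII ⟨D.partner x, hxc, by omega, by rw [D.partner_partner]; omega⟩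
      obtain ⟨v, u, k1, k2, k3, k4, k5, k6, k7, k8, k9⟩ := hd.exists_last
        (S := pos b a + 1) (E := 2 * D.n) (by omega) le_rfl
        (fun e h1 h2 => hflat e (by omega) (hne _ _ (by omega)))
        (fun y h1 h2 => hpart y (by omega) (hne _ _ (by omega)) (hne _ _ (by omega)))
        (fun e h => by
          have : e = finRotate _ a := (pos_inj (b := b)).1 (by omega)
          rw [this]
          exact a6)
        (fun e h => hout e (by omega))
        (fun x w h1 h2 h3 h4 h5 h6 => hT b b x w (by omega) h2 (by rw [a4]; omega)
          (by rw [a4]; omega) h5)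
        ⟨D.partner w, hI w (by omega) (by omega), pos_lt _ _, by rw [D.partner_partner]; omega⟩
      refine ⟨v, u, by omega, k2, k4, hsucc v u k5 fun x hx => ?_, k5, k6, k7, k8⟩
      have := k9 x (by omega) hx.2 (hI x (by omega) (by omega)) (pos_lt _ _)
      rw [this] at hx
      omega

end Disk

end CurveDiagram

/-! ### Shrinking a disk down to a `1`-gon or a strong `2`-gon. -/

namespace CurveDiagram

variable {D : CurveDiagram}

/-- A simple loop of the curve bounds a disk. -/
theorem exists_disk_of_loop (hB : D.CyclesBound (ZMod 2)) (b : Fin (2 * D.n))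
    (hs : ∀ x, 0 < pos b x → pos b x < pos b (D.partner b) →
      pos b (D.partner b) < pos b (D.partner x)) :
    ∃ h, D.Disk b (D.partner b) (fun _ => False) h := by
  have hne : pos b (D.partner b) ≠ 0 := fun h => D.partner_ne b (pos_eq_zero.1 h)
  have hlt := pos_lt b (D.partner b)
  obtain ⟨h, hh, hf, hq⟩ := hB.exists_regions (D.isCycle_arc b) ((finRotate _).symm b, true)
  have hpb := pos_finRotate_symm b b
  rw [if_pos (pos_self b)] at hpb
  refine ⟨h, hh, by omega, fun e => by rw [hf, or_false], hs, hq, ?_,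
    Or.inl ⟨rfl, fun _ => id⟩⟩
  rw [← hh.in_out ((hf _).2 (by omega)) ((hf _).2 (lt_irrefl _)), hq]

/-- Two arcs of the curve with the same ends, one of which is a single edge, as a chain. -/
theorem isCycle_bigon {v u : Fin (2 * D.n)} (h0 : 0 < pos v u)
    (h1 : pos v u < pos v (D.partner u)) (h2 : pos v (D.partner u) + 1 < 2 * D.n)
    (hv : D.partner v = finRotate _ (D.partner u)) :
    D.IsCycle fun e => if pos v e < pos v u ∨ e = D.partner u then (1 : ZMod 2) else 0 := by
  have hx2 : pos v (D.partner v) = pos v (D.partner u) + 1 := by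
    rw [hv, pos_finRotate, if_neg (by omega)]
  have hz : ∀ e, (pos v e < pos v u ∨ e = D.partner u) ↔
      (pos v e < pos v u ∨ pos v e = pos v (D.partner u)) := fun e => by rw [pos_inj]
  simp only [hz]
  have gen : ∀ y, y ≠ v → y ≠ u → y ≠ D.partner v → y ≠ D.partner u →
      (if pos v ((finRotate _).symm y) < pos v u ∨
        pos v ((finRotate _).symm y) = pos v (D.partner u) then (1 : ZMod 2) else 0) =
      if pos v y < pos v u ∨ pos v y = pos v (D.partner u) then (1 : ZMod 2) else 0 := by
    intro y h1 h2 h3 h4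
    have h1' : pos v y ≠ 0 := fun h => h1 (pos_eq_zero.1 h)
    have h2' : pos v y ≠ pos v u := fun h => h2 (pos_inj.1 h)
    have h3' : pos v y ≠ pos v (D.partner v) := fun h => h3 (pos_inj.1 h)
    have h4' : pos v y ≠ pos v (D.partner u) := fun h => h4 (pos_inj.1 h)
    rw [pos_finRotate_symm, if_neg h1']
    congr 1
    exact propext (by omega)
  have hv0 := pos_self v
  have hpos : ∀ y, pos v ((finRotate _).symm y) = if pos v y = 0 then 2 * D.n - 1 else pos v y - 1 :=
    pos_finRotate_symm v
  have corner : ∀ y, y = v ∨ y = u →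
      (if pos v ((finRotate _).symm y) < pos v u ∨
        pos v ((finRotate _).symm y) = pos v (D.partner u) then (1 : ZMod 2) else 0) +
      (if pos v ((finRotate _).symm (D.partner y)) < pos v u ∨
        pos v ((finRotate _).symm (D.partner y)) = pos v (D.partner u)
        then (1 : ZMod 2) else 0) =
      (if pos v y < pos v u ∨ pos v y = pos v (D.partner u) then (1 : ZMod 2) else 0) +
      if pos v (D.partner y) < pos v u ∨ pos v (D.partner y) = pos v (D.partner u)
        then (1 : ZMod 2) else 0 := by
    rintro y (rfl | rfl)
    · rw [hpos, hpos]
      split_ifs <;> first | omega | decide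
    · rw [hpos, hpos]
      split_ifs <;> first | omega | decide
  intro y
  by_cases c1 : y = v ∨ y = u
  · exact corner y c1
  by_cases c2 : y = D.partner v ∨ y = D.partner u
  · have := corner (D.partner y) (by
      rcases c2 with rfl | rfl <;> simp only [D.partner_partner, true_or, or_true])
    rw [D.partner_partner] at this
    rw [add_comm, this, add_comm]
  · have hp : ∀ w, y ≠ w → D.partner y ≠ D.partner w := fun w h h' => h (D.partner_injective h')
    have hp' : ∀ w, y ≠ D.partner w → D.partner y ≠ w := fun w h h' =>
      h (by rw [← h', D.partner_partner])
    push Not at c1 c2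
    simp only
    rw [gen y c1.1 c1.2 c2.1 c2.2,
      gen (D.partner y) (hp' _ c2.1) (hp' _ c2.2) (hp _ c1.1) (hp _ c1.2)]

section Step

variable {b c : Fin (2 * D.n)} {R : Fin (2 * D.n) → Prop} {h h' : Fin (2 * D.n) × Bool → Bool}
  {v u : Fin (2 * D.n)}

/-- A region function which is constant along the rim of a disk, except for the edge between the
ends of a strand, vanishes there as soon as it does so at one edge. -/
theorem Disk.rim_eq_false (hd : D.Disk b c R h) (hs : D.Strand b c h v u) (hh' : D.IsRegionFun h')
    (hflat : ∀ e, pos b e < pos b c ∨ R e → e ≠ D.partner u → Flat h' e)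
    (hpart : ∀ y, pos b c < pos b y → ¬ (pos b v ≤ pos b y ∧ pos b y ≤ pos b u) → Flat h' y)
    (hq : h' (D.partner v, true) = false) {e : Fin (2 * D.n)} (he : pos b e < pos b c ∨ R e)
    (hne : e ≠ D.partner u) (s : Bool) : h' (e, s) = false := by
  have hx2 : pos b (D.partner v) = pos b (D.partner u) + 1 := by
    have h1 := hs.pos_lt_pos
    have h2 := pos_finRotate b (D.partner u)
    rw [← hs.succ] at h2
    split_ifs at h2 <;> omega
  have k1 := hs.lt_end
  have k2 := hs.lt
  have k3 := hs.pos_pos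
  have k4 := hs.pos_lt
  have hb0 := pos_self b
  have hflat' : ∀ e, pos b e < pos b c → pos b e ≠ pos b (D.partner u) → Flat h' e :=
    fun e h1 h2 => hflat e (Or.inl h1) fun h => h2 (by rw [h])
  have hpart' : ∀ y, 0 < pos b y → pos b y < pos b c → pos b y ≠ pos b (D.partner u) →
      pos b y ≠ pos b (D.partner v) → Flat h' (D.partner y) := by
    intro y h1 h2 h3 h4
    have h5 := hd.simple y h1 h2
    refine hpart _ h5 fun h6 => ?_
    have n1 : pos b (D.partner y) ≠ pos b v := fun h => h4 (by
      rw [← pos_inj.1 h, D.partner_partner])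
    have n2 : pos b (D.partner y) ≠ pos b u := fun h => h3 (by
      rw [← pos_inj.1 h, D.partner_partner])
    have h7 := hs.partner_inner (D.partner y) (by omega) (by omega)
    rw [D.partner_partner] at h7
    omega
  have tail : ∀ e, pos b (D.partner v) ≤ pos b e → pos b e < pos b c → h' (e, true) = false := by
    intro e h1 h2
    refine (hh'.arc_const (b := b) (S := pos b (D.partner v)) (E := pos b c - 1)
      (fun e h1 h2 => hflat' e (by omega) (by omega))
      (fun y h1 h2 => hpart' y (by omega) (by omega) (by omega) (by omega))
      (by omega) (by omega) (by omega) (by omega)).trans hq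
  have hpc := pos_finRotate_symm b c
  rw [if_neg (by omega)] at hpc
  have hlast := tail ((finRotate _).symm c) (by omega) (by omega)
  -- The value is carried around the corners: from the end of the arc to `b`, directly or through
  -- the closing edge `a`.
  have close : h' (b, true) = false ∧ ∀ e, R e → h' (e, true) = false := by
    rcases hd.closed with ⟨hbc, hR⟩ | ⟨a, a1, a2, a3, a4, hR, -, -⟩
    · refine ⟨?_, fun e he => (hR e he).elim⟩
      have hcb : D.partner c = b := by rw [← hbc, D.partner_partner]
      have := hh'.in_out (y := c) (hflat' _ (by omega) (by omega))
        (by rw [hcb]; exact hflat' _ (by omega) (by omega))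
      rw [← hcb, ← this, hlast]
    · have fa : Flat h' a := hflat a (Or.inr ((hR a).2 rfl)) fun h => by rw [h] at a1; omega
      have e1 := hh'.in_out (y := c) (hflat' _ (by omega) (by omega)) (by rwa [a3])
      rw [a3, hlast] at e1
      have hb' : D.partner (finRotate _ a) = b := by rw [← a4, D.partner_partner]
      have e2 := hh'.in_out (y := finRotate _ a) (by rwa [Equiv.symm_apply_apply])
        (by rw [hb']; exact hflat' _ (by omega) (by omega))
      rw [Equiv.symm_apply_apply, hb', ← e1] at e2
      exact ⟨e2.symm, fun e he => by rw [(hR e).1 he, ← e1]⟩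
  have key : h' (e, true) = false := by
    rcases he with he | he
    · have n1 : pos b e ≠ pos b (D.partner u) := fun h => hne (pos_inj.1 h)
      by_cases h2 : pos b (D.partner v) ≤ pos b e
      · exact tail e h2 he
      · exact (hh'.arc_const (b := b) (S := 0) (E := pos b (D.partner u) - 1)
          (fun e h1 h2 => hflat' e (by omega) (by omega))
          (fun y h1 h2 => hpart' y (by omega) (by omega) (by omega) (by omega))
          (by omega) (by omega) (by omega) (by omega)).trans close.1
    · exact close.2 e he
  cases s
  · rw [← hflat e he hne, key]
  · exact key

/-- Comparison of a disk with a smaller one next to a strand. -/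
theorem Disk.card_lt (hd : D.Disk b c R h) (hs : D.Strand b c h v u) (hh' : D.IsRegionFun h')
    (hrim : ∀ e, pos b e < pos b c ∨ R e → e ≠ D.partner u → ∀ s, h' (e, s) = false)
    (hout : ∀ e, pos b c ≤ pos b e → ¬ R e → ¬ (pos b v ≤ pos b e ∧ pos b e < pos b u) → Flat h' e)
    (hx : ∀ s, h' (D.partner u, s) = true → h (D.partner u, s) = true) :
    (Finset.univ.filter fun r => h' r = true).card <
      (Finset.univ.filter fun r => h r = true).card := by
  have hx2 := hs.pos_lt_pos
  have k4 := hs.pos_lt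
  have hne : D.partner v ≠ D.partner u := fun h => by rw [h] at hx2; exact lt_irrefl _ hx2
  have hr := hrim (D.partner v) (Or.inl k4) hne
  obtain ⟨s, hs'⟩ : ∃ s, h (D.partner v, s) = true := by
    by_contra hcon
    push Not at hcon
    refine (hd.flat_iff (D.partner v)).1 ?_ (Or.inl k4)
    have h1 := hcon true
    have h2 := hcon false
    rw [ne_eq, Bool.not_eq_true] at h1 h2
    exact h1.trans h2.symm
  refine card_lt_of_regions hd.region hh' (fun e => ?_) hs' (hr s)
  by_cases he : pos b e < pos b c ∨ R e
  · refine Or.inr fun s h1 => ?_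
    by_cases hne : e = D.partner u
    · rw [hne] at h1 ⊢
      exact hx s h1
    · rw [hrim e he hne s] at h1
      exact absurd h1 (by decide)
  · by_cases hin : pos b v ≤ pos b e ∧ pos b e < pos b u
    · exact Or.inr fun s _ => hs.inner e s hin.1 hin.2
    · have he' := not_or.1 he
      exact Or.inl ⟨(hd.flat_iff e).2 he, hout e (by omega) he'.2 hin⟩

/-- If a strand meets itself, then it contains a simple loop inside of the disk. -/
theorem Disk.exists_smaller_of_loop (hB : D.CyclesBound (ZMod 2)) (hd : D.Disk b c R h)
    (hs : D.Strand b c h v u)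
    (hloop : ∃ y, pos b v < pos b y ∧ pos b y < pos b u ∧ pos b v < pos b (D.partner y) ∧
      pos b (D.partner y) < pos b y) :
    ∃ b' c' R' h', D.Disk b' c' R' h' ∧ (Finset.univ.filter fun r => h' r = true).card <
      (Finset.univ.filter fun r => h r = true).card := by
  classical
  obtain ⟨y, hy⟩ := hloop
  -- The first return of the strand to one of its own points closes a loop that is simple.
  obtain ⟨w, hw, hmin⟩ := (Finset.univ.filter fun y => pos b v < pos b y ∧ pos b y < pos b u ∧
    pos b v < pos b (D.partner y) ∧ pos b (D.partner y) < pos b y).exists_min_image (pos b)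
    ⟨y, by simpa using hy⟩
  simp only [Finset.mem_filter, Finset.mem_univ, true_and] at hw hmin
  obtain ⟨w1, w2, w3, w4⟩ := hw
  have hN := pos_lt b u
  have hx2 : pos b (D.partner v) = pos b (D.partner u) + 1 := by
    have h1 := hs.pos_lt_pos
    have h2 := pos_finRotate b (D.partner u)
    rw [← hs.succ] at h2
    split_ifs at h2 <;> omega
  have k1 := hs.lt_end
  have k3 := hs.pos_pos
  have k4 := hs.pos_lt
  have hpos : ∀ e, pos (D.partner w) e = if pos b (D.partner w) ≤ pos b e then
      pos b e - pos b (D.partner w) else pos b e + 2 * D.n - pos b (D.partner w) :=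
    fun e => pos_change b _ e
  have hfirst : ∀ x, pos b v < pos b x → pos b x < pos b w → x ≠ D.partner w →
      ¬ (pos b v ≤ pos b (D.partner x) ∧ pos b (D.partner x) ≤ pos b w) := by
    intro x h1 h2 h3 h4
    have n1 : pos b (D.partner x) ≠ pos b w := fun h => h3 (by
      rw [← pos_inj.1 h, D.partner_partner])
    have n2 : pos b (D.partner x) ≠ pos b v := fun h => by
      rw [← pos_inj.1 h, D.partner_partner] at hx2 k4
      omega
    have n3 : pos b (D.partner x) ≠ pos b x := fun h => D.partner_ne x (pos_inj.1 h)
    have m1 := hmin x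
    have m2 := hmin (D.partner x)
    rw [D.partner_partner] at m2
    rcases lt_or_gt_of_ne n3 with h5 | h5
    · have := m1 ⟨h1, by omega, by omega, h5⟩
      omega
    · have := m2 ⟨by omega, by omega, h1, h5⟩
      omega
  have harc : ∀ e, pos (D.partner w) e < pos (D.partner w) w ↔
      (pos b (D.partner w) ≤ pos b e ∧ pos b e < pos b w) := fun e => by
    have := pos_lt b e
    rw [hpos, hpos]
    split_ifs <;> omega
  obtain ⟨h', hd'⟩ := exists_disk_of_loop hB (D.partner w) (by
    rw [D.partner_partner]
    intro x h1 h2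
    have h3 := (harc x).1 h2
    have hne : x ≠ D.partner w := fun h => by rw [h, pos_self] at h1; omega
    have h4 := hfirst x (by omega) h3.2 hne
    have := pos_lt b (D.partner x)
    rw [hpos, hpos]
    split_ifs <;> omega)
  rw [D.partner_partner] at hd'
  refine ⟨_, _, _, h', hd', ?_⟩
  have hh' := hd'.region
  have hflat : ∀ e, ¬ (pos b (D.partner w) ≤ pos b e ∧ pos b e < pos b w) → Flat h' e :=
    fun e he => (hd'.flat_iff e).2 (by rwa [or_false, harc])
  have hpw := pos_finRotate_symm b (D.partner w)
  rw [if_neg (by omega)] at hpw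
  -- Before `partner w` the strand does not meet the loop, so the entrance of the strand lies
  -- outside the new disk; from there this passes to the rim of the old one.
  have hv : h' (v, true) = false := by
    rw [← hd'.outer_start]
    refine hh'.arc_const (b := b) (S := pos b v) (E := pos b (D.partner w) - 1)
      (fun e h1 h2 => hflat e (by omega)) (fun y h1 h2 => hflat _ fun h => ?_)
      (by omega) (by omega) (by omega) (by omega)
    exact hfirst y h1 (by omega) (fun h => by rw [h] at h2; omega) (by omega)
  have hv2 : h' (D.partner v, true) = false := by
    rw [← hh'.out_out (hflat v (by omega)) (hflat _ (by omega)), hv]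
  have hv1 : h' (D.partner u, true) = false := by
    have := hh'.in_out (y := D.partner v)
      (by rw [hs.succ, Equiv.symm_apply_apply]; exact hflat _ (by omega))
      (by rw [D.partner_partner]; exact hflat _ (by omega))
    rw [D.partner_partner, hv, hs.succ, Equiv.symm_apply_apply] at this
    exact this
  have hR : ∀ e, pos b e < pos b c ∨ R e →
      ¬ (pos b (D.partner w) ≤ pos b e ∧ pos b e < pos b w) := by
    rintro e he ⟨h1, h2⟩
    refine (hd.flat_iff e).1 ?_ he
    have := hs.inner e
    exact (this true (by omega) (by omega)).trans (this false (by omega) (by omega)).symm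
  refine hd.card_lt hs hh' (fun e he hne s => ?_) (fun e h1 h2 h3 => hflat e (by omega))
    fun s hs1 => ?_
  · exact hd.rim_eq_false hs hh' (fun e h1 _ => hflat e (hR e h1))
      (fun y _ h2 => hflat y (by omega)) hv2 he hne s
  · exfalso
    have hf : Flat h' (D.partner u) := hflat _ (by omega)
    cases s
    · rw [← hf, hv1] at hs1
      exact absurd hs1 (by decide)
    · rw [hv1] at hs1
      exact absurd hs1 (by decide)

/-- A simple strand cuts off a smaller disk. -/
theorem Disk.exists_smaller_of_simple (hB : D.CyclesBound (ZMod 2)) (hd : D.Disk b c R h)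
    (hs : D.Strand b c h v u)
    (hsimple : ∀ y, pos b v < pos b y → pos b y < pos b u → pos b v < pos b (D.partner y) →
      ¬ pos b (D.partner y) < pos b u) :
    ∃ b' c' R' h', D.Disk b' c' R' h' ∧ (Finset.univ.filter fun r => h' r = true).card <
      (Finset.univ.filter fun r => h r = true).card := by
  have hN := pos_lt b u
  have hx2 : pos b (D.partner v) = pos b (D.partner u) + 1 := by
    have h1 := hs.pos_lt_pos
    have h2 := pos_finRotate b (D.partner u)
    rw [← hs.succ] at h2
    split_ifs at h2 <;> omega
  have k1 := hs.lt_end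
  have k2 := hs.lt
  have k3 := hs.pos_pos
  have k4 := hs.pos_lt
  have hpos : ∀ e, pos v e = if pos b v ≤ pos b e then
      pos b e - pos b v else pos b e + 2 * D.n - pos b v := fun e => pos_change b _ e
  have hvu : pos v u = pos b u - pos b v := by rw [hpos, if_pos (by omega)]
  have hvx : pos v (D.partner u) = pos b (D.partner u) + 2 * D.n - pos b v := by
    rw [hpos, if_neg (by omega)]
  obtain ⟨h', hh', hf, hq⟩ := hB.exists_regions (isCycle_bigon (v := v) (u := u) (by omega)
    (by omega) (by omega) hs.succ) (D.partner v, true)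
  have harc : ∀ e, pos v e < pos v u ↔ (pos b v ≤ pos b e ∧ pos b e < pos b u) := fun e => by
    have := pos_lt b e
    rw [hpos, hvu]
    split_ifs <;> omega
  have hflat : ∀ e, ¬ (pos b v ≤ pos b e ∧ pos b e < pos b u) → e ≠ D.partner u → Flat h' e :=
    fun e h1 h2 => (hf e).2 (by rw [harc]; tauto)
  have hne : ∀ x y : Fin (2 * D.n), pos b x ≠ pos b y → x ≠ y := fun x y h h' => h (by rw [h'])
  have hR : ∀ e, pos b e < pos b c ∨ R e → ¬ (pos b v ≤ pos b e ∧ pos b e < pos b u) := by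
    rintro e he ⟨h1, h2⟩
    refine (hd.flat_iff e).1 ?_ he
    have := hs.inner e
    exact (this true (by omega) (by omega)).trans (this false (by omega) (by omega)).symm
  have hrim : ∀ e, pos b e < pos b c ∨ R e → e ≠ D.partner u → ∀ s, h' (e, s) = false :=
    fun e he hne' s => hd.rim_eq_false hs hh' (fun e h1 h2 => hflat e (hR e h1) h2)
      (fun y h1 h2 => hflat y (by omega) (hne _ _ (by omega))) hq he hne' s
  have hsym : (finRotate _).symm (D.partner v) = D.partner u := by
    rw [hs.succ, Equiv.symm_apply_apply]
  have hpv := pos_finRotate_symm b v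
  rw [if_neg (by omega)] at hpv
  have hpx := pos_finRotate_symm b (D.partner u)
  rw [if_neg (by omega)] at hpx
  have fpv : Flat h' ((finRotate _).symm v) := hflat _ (by omega) (hne _ _ (by omega))
  have start : h' ((finRotate _).symm v, true) = false := by
    rw [hh'.in_out fpv (hflat _ (by omega) (hne _ _ (by omega))), hq]
  have hx0 : h' ((finRotate _).symm (D.partner u), true) = false :=
    hrim _ (Or.inl (by omega)) (hne _ _ (by omega)) true
  have finish : h' (u, true) = false := by
    have := hh'.in_out (y := D.partner u) (hflat _ (by omega) (hne _ _ (by omega)))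
      (by rw [D.partner_partner]; exact hflat _ (by omega) (hne _ _ (by omega)))
    rw [D.partner_partner] at this
    rw [← this, hx0]
  have hp2 := D.partner_partner v
  refine ⟨v, u, fun e => e = D.partner u, h', ⟨hh', by omega, hf, fun x h1 h2 => ?_, start, finish,
    Or.inr ⟨D.partner u, by omega, by omega, rfl, hs.succ, fun _ => Iff.rfl, hx0, ?_⟩⟩,
    hd.card_lt hs hh' hrim (fun e h1 h2 h3 => hflat e h3 (hne _ _ (by omega))) fun s hs1 => ?_⟩
  · have h3 := (harc x).1 h2
    have hxv : pos b x ≠ pos b v := fun h => by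
      rw [pos_inj.1 h, pos_self] at h1
      omega
    have h4 := hs.partner_inner x (by omega) h3.2
    have h5 := hsimple x (by omega) h3.2
    have n1 : pos b (D.partner x) ≠ pos b u := fun h => by
      rw [← pos_inj.1 h, D.partner_partner] at k3 hx2
      omega
    have n2 : pos b (D.partner x) ≠ pos b v := fun h => by
      rw [← pos_inj.1 h, D.partner_partner] at k4
      omega
    have := pos_lt b (D.partner x)
    rw [hvu, hpos]
    split_ifs <;> omega
  · rw [← hs.succ]
    exact hq
  · have hin := hs.inner v
    -- At the corner `v`, one side of the edge `partner u` shares a region with the strand edge `v`,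
    -- hence lies in the old disk. The other side shares a region with the edge entering `v`, hence
    -- lies outside the new disk.
    cases hl : D.left (D.partner v)
    · have hlv : D.left v = true := by
        rw [← hp2]
        exact left_partner_of_false hl
      cases s
      · have := hd.region.left_out hlv
        rw [hsym] at this
        rw [← this]
        exact hin false le_rfl k2
      · have := hh'.right_in hl
        rw [hsym, hp2, ← fpv, start, hs1] at this
        exact absurd this (by decide)
    · have hlv : D.left v = false := by
        rw [← hp2]
        exact left_partner_of_true hl
      cases s
      · have := hh'.right_in hlv
        rw [hsym, start, hs1] at this
        exact absurd this (by decide)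
      · have := hd.region.left_in hl
        rw [hsym, hp2] at this
        rw [this]
        exact hin true le_rfl k2

theorem Disk.exists_smaller (hB : D.CyclesBound (ZMod 2)) (hT : D.TripleFree)
    (hd : D.Disk b c R h) (hL : 1 < pos b c) :
    ∃ b' c' R' h', D.Disk b' c' R' h' ∧ (Finset.univ.filter fun r => h' r = true).card <
      (Finset.univ.filter fun r => h r = true).card := by
  obtain ⟨v, u, hs⟩ := hd.exists_strand hB hT hL
  by_cases hloop : ∃ y, pos b v < pos b y ∧ pos b y < pos b u ∧ pos b v < pos b (D.partner y) ∧
      pos b (D.partner y) < pos b y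
  · exact hd.exists_smaller_of_loop hB hs hloop
  · refine hd.exists_smaller_of_simple hB hs fun y h1 h2 h3 h4 => ?_
    have hne : pos b (D.partner y) ≠ pos b y := fun h => D.partner_ne y (pos_inj.1 h)
    rcases lt_or_gt_of_ne hne with h5 | h5
    · exact hloop ⟨y, h1, h2, h3, h5⟩
    · exact hloop ⟨D.partner y, h3, h4, by rwa [D.partner_partner], by rwa [D.partner_partner]⟩

end Step

/-- There is a `1`-gon or a strong `2`-gon. -/
def Reducible (D : CurveDiagram) : Prop :=
  ∃ i, D.partner i = finRotate _ i ∨ ∃ j, i ≠ j ∧ D.partner i = finRotate _ j ∧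
    D.partner j = finRotate _ i ∧ D.left i = D.left j

/-- For a `2`-gon only the equality of `left` is in question. If it failed, both sides of the edge
`b` would share corners with edges outside the disk, and `b` would not be a boundary edge. -/
theorem Disk.reducible_of_pos_eq_one {b c : Fin (2 * D.n)} {R : Fin (2 * D.n) → Prop}
    {h : Fin (2 * D.n) × Bool → Bool} (hd : D.Disk b c R h) (hL : pos b c = 1) :
    D.Reducible := by
  have hb0 := pos_self b
  have hc : c = finRotate _ b := eq_of_pos_succ (b := b) (by omega)
  rcases hd.closed with ⟨hbc, -⟩ | ⟨a, a1, a2, a3, a4, hR, a5, a6⟩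
  · exact ⟨b, Or.inl (by rw [hbc, hc])⟩
  have hpa : D.partner a = finRotate _ b := by rw [← a3, D.partner_partner, hc]
  refine ⟨b, Or.inr ⟨a, fun h => by rw [← h] at a1; omega, a4, hpa, ?_⟩⟩
  have hsc : (finRotate _).symm c = b := by rw [hc, Equiv.symm_apply_apply]
  have hpra := pos_finRotate_symm b a
  rw [if_neg (by omega)] at hpra
  have hra : pos b (finRotate _ a) = pos b a + 1 := by rw [pos_finRotate, if_neg (by omega)]
  have hne : ∀ x : Fin (2 * D.n), pos b x ≠ pos b a → x ≠ a := fun x h h' => h (by rw [h'])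
  have hflat : ∀ e, pos b c ≤ pos b e → pos b e ≠ pos b a → Flat h e := fun e h1 h2 =>
    (hd.flat_iff e).2 (by
      rintro (h | h)
      · omega
      · exact hne e h2 ((hR e).1 h))
  have f1 : Flat h ((finRotate _).symm a) := hflat _ (by omega) (by omega)
  have f2 : Flat h (finRotate _ a) := hflat _ (by omega) (by omega)
  have nf : ¬ Flat h b := fun hf => (hd.flat_iff b).1 hf (Or.inl (by omega))
  have hh := hd.region
  by_contra hlr
  apply nf
  cases hl : D.left b
  · have hla : D.left a = true := by
      rw [hl] at hlr
      simpa using Ne.symm hlr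
    have hlc : D.left c = false := by
      rw [hc, ← hpa]
      exact left_partner_of_true hla
    have e1 := hh.right_out hl
    rw [a4, a6] at e1
    have e2 := hh.right_in hlc
    rw [hsc, a3, ← f1, a5] at e2
    exact e2.trans e1.symm
  · have hla : D.left a = false := by
      rw [hl] at hlr
      simpa using Ne.symm hlr
    have hlr' : D.left (finRotate _ a) = false := by
      rw [← a4]
      exact left_partner_of_true hl
    have e1 := hh.right_out hlr'
    rw [← a4, D.partner_partner, a4, ← f2, a6] at e1
    have e2 := hh.right_in hla
    rw [hpa, Equiv.symm_apply_apply, a5] at e2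
    exact e1.symm.trans e2

/-- Descent on the number of edge sides whose region belongs to the disk. -/
theorem Disk.reducible (hB : D.CyclesBound (ZMod 2)) (hT : D.TripleFree) (m : ℕ) :
    ∀ {b c : Fin (2 * D.n)} {R : Fin (2 * D.n) → Prop} {h : Fin (2 * D.n) × Bool → Bool},
      D.Disk b c R h → (Finset.univ.filter fun r => h r = true).card = m → D.Reducible := by
  induction m using Nat.strong_induction_on with
  | _ m ih =>
    intro b c R h hd hm
    have hp := hd.pos_pos
    by_cases hL : pos b c = 1
    · exact hd.reducible_of_pos_eq_one hL
    · obtain ⟨b', c', R', h', hd', hlt⟩ := hd.exists_smaller hB hT (by omega)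
      exact ih _ (by omega) hd' rfl

/-- A curve without triple chords on the sphere has a `1`-gon or a strong `2`-gon. -/
theorem reducible_of_tripleFree (hn : D.n ≠ 0) (hB : D.CyclesBound (ZMod 2))
    (hT : D.TripleFree) : D.Reducible := by
  classical
  have hex : (Finset.univ.filter fun y : Fin (2 * D.n) => D.partner y < y).Nonempty := by
    let x : Fin (2 * D.n) := ⟨0, by omega⟩
    refine ⟨D.partner x, ?_⟩
    simp only [Finset.mem_filter, Finset.mem_univ, true_and, D.partner_partner]
    rw [Fin.lt_def]
    have : (D.partner x : ℕ) ≠ x := fun h => D.partner_ne x (Fin.ext h)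
    have : (x : ℕ) = 0 := rfl
    omega
  -- The first passage at which a double point is met for the second time closes a simple loop.
  obtain ⟨v, hv, hmin⟩ := Finset.exists_min_image _ (fun y : Fin (2 * D.n) => (y : ℕ)) hex
  simp only [Finset.mem_filter, Finset.mem_univ, true_and, Fin.lt_def] at hv hmin
  obtain ⟨h, hd⟩ := exists_disk_of_loop hB (D.partner v) (by
    rw [D.partner_partner]
    intro x
    have n1 : (D.partner x : ℕ) ≠ x := fun h => D.partner_ne x (Fin.ext h)
    have m1 := hmin x
    have m2 := hmin (D.partner x)
    rw [D.partner_partner] at m2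
    have n2 : (D.partner x : ℕ) = v → (x : ℕ) = D.partner v := fun h => by
      rw [← Fin.ext h, D.partner_partner]
    have b1 := x.2
    have b2 := (D.partner x).2
    have b3 := v.2
    unfold pos
    intro h1 h2
    split_ifs at * <;> omega)
  exact Disk.reducible hB hT _ hd rfl

end CurveDiagram

/-! ### The inclusions. -/

namespace KnotProjection

theorem obtained_of_tripleChords_eq_zero (m : ℕ) :
    ∀ P : KnotProjection, P.n = m → P.tripleChords = 0 → P.Obtained := by
  induction m using Nat.strong_induction_on with
  | _ m ih =>
    intro P hm hP
    by_cases hn : P.n = 0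
    · exact Obtained.simple P hn
    have : Fact (Nat.Prime 2) := ⟨Nat.prime_two⟩
    obtain ⟨i, hi | ⟨j, hij, hi, hj, hl⟩⟩ := CurveDiagram.reducible_of_tripleFree hn
      (P.cyclesBound hn (ZMod 2)) (CurveDiagram.tripleFree_of (P.tripleChords_eq_zero_iff.1 hP))
    · obtain ⟨P', hmove, hlt, h0⟩ := P.exists_move1b hP hi
      exact Obtained.inv1b P P' (ih _ (by omega) P' rfl h0) hmove
    · obtain ⟨P', hmove, hlt, h0⟩ := P.exists_moveS2b hP hij hi hj hl
      exact Obtained.invS2b P P' (ih _ (by omega) P' rfl h0) hmove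

theorem tripleChords_eq_zero_of_crossPairs (P : KnotProjection) (h : P.crossPairs = 0) :
    P.tripleChords = 0 := by
  rw [tripleChords_eq_zero_iff]
  intro x y z h1 h2 h3 h4
  rw [crossPairs, Finset.card_eq_zero, Finset.filter_eq_empty_iff] at h
  exact (h (x := (x, y)) (Finset.mem_univ _) ⟨h1, h2.trans h3, h4⟩).elim

end KnotProjection

theorem corollary1 :
    setS ⊆ {P : KnotProjection | P.arnold = 0} ∧
    {P : KnotProjection | P.tripleChords = 0} ⊆ setS ∧
    {P : KnotProjection | P.crossPairs = 0} ⊆ {P : KnotProjection | P.tripleChords = 0} :=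
  ⟨fun _ hP => hP.arnold_eq_zero,
    fun P hP => KnotProjection.obtained_of_tripleChords_eq_zero _ P rfl hP,
    fun P hP => P.tripleChords_eq_zero_of_crossPairs hP⟩
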